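/- Let $n\ge 3$ and $m>0$. Let $(M,g)$ be the complete spatial Schwarzschild manifold of mass $m$, that is, $M=\mathbb{R}^n\setminus\{0\}$ with $$g=\Bigl(1+\frac{m}{2|x|^{n-2}}\Bigr)^{\frac{4}{n-2}}\,\delta ,$$ where $\delta$ is the Euclidean metric. Let $\Sigma_\rho=\{|x|=\rho\}$ denote the rotationally symmetric spheres, let $\Sigma_{0}=\{|x|=\rho_0\}$, $\rho_0=(m/2)^{1/(n-2)}$, be the horizon (the unique minimal one among them), and let $M_+=\{|x|>\rho_0\}$, $M_-=\{0<|x|<\rho_0\}$ be the two components of $M\setminus\Sigma_{0}$. Consider the equation $$-(\Delta_g\lambda)\,g+\nabla^2_g\lambda-\lambda\,\mathrm{Ric}(g)=g \qquad (*)$$ for a smooth function $\lambda$. A smooth Riemannian metric on a compact manifold with smooth boundary is called critical if it satisfies $(*)$ for some smooth function $\lambda$, defined on the whole manifold (including the boundary), that vanishes on the boundary. Then: (i) There exist smooth functions $\lambda$ on $M$ satisfying $(*)$ on $(M,g)$. (ii) For every sphere $\Sigma_{\zeta_1}$ in $M_+$ there is a sphere $\Sigma_{\zeta_2}$ in $M_-$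 such that $g$ is a critical metric on the closed domain $\{\zeta_2\le|x|\le\zeta_1\}$ bounded by the two spheres. Likewise, for every sphere $\Sigma_{\zeta_2}$ in $M_-$ there is a sphere $\Sigma_{\zeta_1}$ in $M_+$ with the same property. (iii) There is a sphere $\Sigma_\theta$ in $M_+$ such that the following holds. Let $\tilde\Omega$ be the manifold with boundary obtained from the closed domain $\Omega=\{\rho_0\le|x|\le\theta\}$ bounded by $\Sigma_\theta$ and $\Sigma_{0}$ by identifying antipodal points of $\Sigma_{0}$; its smooth structure is that of the quotient of $\{\rho_0^2/\theta\le|x|\le\theta\}$ by the free isometric involution $x\mapsto-\rho_0^2x/|x|^2$, of which $\Omega$ is a fundamental domain. Let $\tilde g$ be the Riemannian metric on $\tilde\Omega$ that pulls back to $g$ under the projection. Then $\tilde g$ is a critical metric on $\tilde\Omega$. (Equivalently one may start from the domain $\{\rho_0^2/\theta\le|x|\le\rho_0\}$, bounded by $\Sigma_{0}$ and a sphere in $M_-$, which yields the same quotient.) -/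

import Mathlib

set_option maxSynthPendingDepth 3

open Set Metric Manifold
open scoped ContDiff Topology

noncomputable section

/-! ### Riemannian geometry in a coordinate domain

`S` is a subset of a finite-dimensional real vector space `E` on which derivatives are taken (the
whole space, or a half-space), `G p : E → E → ℝ` is the matrix of a metric at `p`. -/

namespace Coord

variable {E : Type*} [NormedAddCommGroup E] [NormedSpace ℝ E]

/-- Christoffel symbols (Levi-Civita connection) of `G`: the vector `Γ_p(v,w)` with
`G_p(Γ_p(v,w), z) = ½ (∂_v G(w,z) + ∂_w G(v,z) - ∂_z G(v,w))`. -/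
def christoffel (S : Set E) (G : E → E →L[ℝ] E →L[ℝ] ℝ) (p : E) : E →L[ℝ] E →L[ℝ] E :=
  let D : E →L[ℝ] E →L[ℝ] E →L[ℝ] ℝ := fderivWithin ℝ G S p
  let T : E →L[ℝ] E →L[ℝ] E →L[ℝ] ℝ :=
    (ContinuousLinearMap.flipₗᵢ ℝ E E ℝ : (E →L[ℝ] E →L[ℝ] ℝ) →L[ℝ] E →L[ℝ] E →L[ℝ] ℝ).comp D.flip
  let A : E →L[ℝ] E →L[ℝ] E →L[ℝ] ℝ := D + D.flip - T
  (ContinuousLinearMap.compL ℝ E (E →L[ℝ] ℝ) E (G p).inverse).comp ((1 / 2 : ℝ) • A)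

/-- The curvature `z ↦ R(z,v)w = ∇_z ∇_v w - ∇_v ∇_z w` for constant fields `z, v, w`, that is
`∂_z Γ(v,w) - ∂_v Γ(z,w) + Γ(z,Γ(v,w)) - Γ(v,Γ(z,w))`. -/
def curvature (S : Set E) (G : E → E →L[ℝ] E →L[ℝ] ℝ) (p v w : E) : E →L[ℝ] E :=
  let Γ : E →L[ℝ] E →L[ℝ] E := christoffel S G p
  let DΓ : E →L[ℝ] E →L[ℝ] E →L[ℝ] E := fderivWithin ℝ (christoffel S G) S p
  (DΓ.flip v).flip w - (DΓ v).flip w + Γ.flip (Γ v w) - (Γ v).comp (Γ.flip w)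

/-- Ricci curvature: `Ric(v,w)` is the trace of `z ↦ R(z,v)w`. -/
def ricci (S : Set E) (G : E → E →L[ℝ] E →L[ℝ] ℝ) (p v w : E) : ℝ :=
  LinearMap.trace ℝ E (curvature S G p v w).toLinearMap

/-- Hessian `∇²f(v,w) = ∂_v ∂_w f - df(Γ(v,w))`. -/
def hessian (S : Set E) (G : E → E →L[ℝ] E →L[ℝ] ℝ) (f : E → ℝ) (p : E) :
    E →L[ℝ] E →L[ℝ] ℝ :=
  fderivWithin ℝ (fderivWithin ℝ f S) S p -
    (ContinuousLinearMap.compL ℝ E E ℝ (fderivWithin ℝ f S p)).comp (christoffel S G p)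

/-- Laplacian: the trace of the Hessian with respect to `G`. -/
def laplacian (S : Set E) (G : E → E →L[ℝ] E →L[ℝ] ℝ) (f : E → ℝ) (p : E) : ℝ :=
  LinearMap.trace ℝ E ((G p).inverse.comp (hessian S G f p)).toLinearMap

end Coord

/-! ### Critical metrics on manifolds with boundary -/

section Manifold

variable {E : Type*} [NormedAddCommGroup E] [NormedSpace ℝ E]
  {H : Type*} [TopologicalSpace H] (I : ModelWithCorners ℝ E H)
  {M : Type*} [TopologicalSpace M] [ChartedSpace H M]
  {E' : Type*} [NormedAddCommGroup E'] [NormedSpace ℝ E']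
  {H' : Type*} [TopologicalSpace H'] (I' : ModelWithCorners ℝ E' H')
  {M' : Type*} [TopologicalSpace M'] [ChartedSpace H' M']

/-- The pullback `f^* g`, `(v, w) ↦ g (df v, df w)`, of a field `g` of bilinear forms. -/
def pullbackForm (f : M → M')
    (g : Π y : M', TangentSpace I' y →L[ℝ] TangentSpace I' y →L[ℝ] ℝ) (x : M) :
    TangentSpace I x →L[ℝ] TangentSpace I x →L[ℝ] ℝ :=
  let B : E' →L[ℝ] E' →L[ℝ] ℝ := g (f x)
  let D : E →L[ℝ] E' := mfderiv I I' f x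
  (B.bilinearComp D D : E →L[ℝ] E →L[ℝ] ℝ)

/-- The metric `g` written in the (extended) chart at `x`. -/
def metricInChart (g : Π y : M, TangentSpace I y →L[ℝ] TangentSpace I y →L[ℝ] ℝ)
    (x : M) (p : E) : E →L[ℝ] E →L[ℝ] ℝ :=
  let B : E →L[ℝ] E →L[ℝ] ℝ := g ((extChartAt I x).symm p)
  let D : E →L[ℝ] E := mfderivWithin 𝓘(ℝ, E) I (extChartAt I x).symm (range I) p
  B.bilinearComp D D

/-- The equation `-(Δ_g f) g + ∇²_g f - f Ric(g) = g` at every point of `M`. At each point it is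
written in the preferred chart around this point; both sides are tensors. -/
def SolvesCriticalEquation (g : Π y : M, TangentSpace I y →L[ℝ] TangentSpace I y →L[ℝ] ℝ)
    (f : M → ℝ) : Prop :=
  ∀ x : M,
    let S : Set E := range I
    let G : E → E →L[ℝ] E →L[ℝ] ℝ := metricInChart I g x
    let F : E → ℝ := f ∘ (extChartAt I x).symm
    let p : E := extChartAt I x x
    ∀ v w : E,
      -Coord.laplacian S G F p * G p v w + Coord.hessian S G F p v w
        - f x * Coord.ricci S G p v w = G p v w

/-- `g` is a smooth Riemannian metric on `M`. -/
def IsSmoothMetric [IsManifold I ∞ M]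
    (g : Π y : M, TangentSpace I y →L[ℝ] TangentSpace I y →L[ℝ] ℝ) : Prop :=
  ∃ G : Bundle.ContMDiffRiemannianMetric I ∞ E (fun x : M ↦ TangentSpace I x),
    ∀ x, G.inner x = g x

/-- A smooth Riemannian metric `g` on a compact manifold `M` with boundary is *critical* if
`-(Δ_g f) g + ∇²_g f - f Ric(g) = g` for some smooth function `f` vanishing on the boundary. -/
def IsCriticalMetric [IsManifold I ∞ M] [T2Space M] [CompactSpace M]
    (g : Π y : M, TangentSpace I y →L[ℝ] TangentSpace I y →L[ℝ] ℝ) : Prop :=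
  IsSmoothMetric I g ∧
    ∃ f : M → ℝ, ContMDiff I 𝓘(ℝ, ℝ) ∞ f ∧ (∀ x ∈ I.boundary M, f x = 0) ∧
      SolvesCriticalEquation I g f

end Manifold

/-! ### The spatial Schwarzschild manifold

The dimension is `n = k + 1`, so that the exponent `n - 2` is `k - 1`. -/

section Schwarzschild

/-- `ℝⁿ` with `n = k + 1`. -/
abbrev Eucl (k : ℕ) : Type := EuclideanSpace ℝ (Fin (k + 1))

instance factFinrankEucl (k : ℕ) : Fact (Module.finrank ℝ (Eucl k) = k + 1) :=
  ⟨finrank_euclideanSpace_fin⟩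

/-- The unit sphere `S^{n-1}` in `ℝⁿ`. -/
abbrev Sph (k : ℕ) : Type := sphere (0 : Eucl k) 1

/-- The form `(1 + m / (2 |p|^{n-2}))^{4/(n-2)} ⟨v, w⟩` on `ℝⁿ` (used away from the origin). -/
def schwarzschildForm (k : ℕ) (m : ℝ) (p : Eucl k) :
    TangentSpace 𝓘(ℝ, Eucl k) p →L[ℝ] TangentSpace 𝓘(ℝ, Eucl k) p →L[ℝ] ℝ :=
  ((1 + m / (2 * ‖p‖ ^ (k - 1))) ^ ((4 : ℝ) / ((k : ℝ) - 1)) • innerSL ℝ :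
    Eucl k →L[ℝ] Eucl k →L[ℝ] ℝ)

/-- The manifold `ℝⁿ \ {0}`. -/
def puncturedSpace (k : ℕ) : TopologicalSpace.Opens (Eucl k) := ⟨{0}ᶜ, isOpen_compl_singleton⟩

/-- The (complete, two-ended) spatial Schwarzschild metric of mass `m` on `ℝⁿ \ {0}`. -/
def schwarzschildMetric (k : ℕ) (m : ℝ) (x : puncturedSpace k) :
    TangentSpace 𝓘(ℝ, Eucl k) x →L[ℝ] TangentSpace 𝓘(ℝ, Eucl k) x →L[ℝ] ℝ :=
  pullbackForm 𝓘(ℝ, Eucl k) 𝓘(ℝ, Eucl k) ((↑) : puncturedSpace k → Eucl k)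
    (schwarzschildForm k m) x

/-- The area radius of the sphere `|x| = ρ`, whose induced metric is `(areaRadius k m ρ)²` times
the metric of the unit sphere; the sphere is minimal iff the derivative of this radius vanishes. -/
def areaRadius (k : ℕ) (m ρ : ℝ) : ℝ :=
  ρ * (1 + m / (2 * ρ ^ (k - 1))) ^ ((2 : ℝ) / ((k : ℝ) - 1))

/-- The horizon is the sphere `|x| = (m/2)^{1/(n-2)}`. -/
def horizonRadius (k : ℕ) (m : ℝ) : ℝ := (m / 2) ^ ((1 : ℝ) / ((k : ℝ) - 1))

lemma horizonRadius_pos (k : ℕ) {m : ℝ} (hm : 0 < m) : 0 < horizonRadius k m :=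
  Real.rpow_pos_of_pos (by positivity) _

/-- Among the spheres `|x| = ρ` exactly the horizon is minimal. -/
lemma deriv_areaRadius_eq_zero_iff {k : ℕ} (hk : 2 ≤ k) {m : ℝ} (hm : 0 < m) {ρ : ℝ}
    (hρ : 0 < ρ) : deriv (areaRadius k m) ρ = 0 ↔ ρ = horizonRadius k m := by
  obtain ⟨j, rfl⟩ : ∃ j, k = j + 2 := ⟨k - 2, by omega⟩
  have hJ : ((j + 2 : ℕ) : ℝ) - 1 = ((j + 1 : ℕ) : ℝ) := by push_cast; ring
  have hj : ((j + 1 : ℕ) : ℝ) ≠ 0 := by positivity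
  have hk1 : j + 2 - 1 = j + 1 := rfl
  have hu : 0 < 1 + m / (2 * ρ ^ (j + 1)) := by positivity
  have h1 : HasDerivAt (fun t : ℝ ↦ 1 + m / (2 * t ^ (j + 1)))
      (-(m * (((j + 1 : ℕ) : ℝ) * ρ ^ j)) / (2 * (ρ ^ (j + 1)) ^ 2)) ρ := by
    have hd : HasDerivAt (fun t : ℝ ↦ 2 * t ^ (j + 1)) (2 * (((j + 1 : ℕ) : ℝ) * ρ ^ j)) ρ := by
      simpa using (hasDerivAt_pow (j + 1) ρ).const_mul 2
    have := ((hasDerivAt_const ρ m).div hd (by positivity)).const_add 1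
    refine this.congr_deriv ?_
    have h0 : ρ ^ (j + 1) ≠ 0 := (pow_pos hρ _).ne'
    rw [div_eq_div_iff (by positivity) (by positivity)]
    ring
  have h2 := (hasDerivAt_id ρ).mul (h1.rpow_const (p := 2 / ((j + 1 : ℕ) : ℝ)) (Or.inl hu.ne'))
  have h3 : deriv (areaRadius (j + 2) m) ρ =
      (1 + m / (2 * ρ ^ (j + 1))) ^ (2 / ((j + 1 : ℕ) : ℝ) - 1) *
        (1 - m / (2 * ρ ^ (j + 1))) := by
    have : areaRadius (j + 2) m = (id : ℝ → ℝ) * fun t : ℝ ↦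
        (1 + m / (2 * t ^ (j + 1))) ^ (2 / ((j + 1 : ℕ) : ℝ)) := by
      funext t
      simp only [areaRadius, hJ, hk1, Pi.mul_apply, id]
    rw [this, h2.deriv]
    rw [Real.rpow_sub_one hu.ne']
    simp only [id]
    field_simp
    ring
  rw [h3, mul_eq_zero, or_iff_right (Real.rpow_pos_of_pos hu _).ne', sub_eq_zero, eq_comm,
    div_eq_one_iff_eq (by positivity), horizonRadius, hJ, one_div,
    Real.eq_rpow_inv hρ.le (by positivity) hj, Real.rpow_natCast]
  constructor <;> intro h <;> linarith

/-- The manifold with boundary `[a, b] × S^{n-1}`; for `0 < a` it is the closed domain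
`a ≤ |x| ≤ b` of `ℝⁿ \ {0}` in polar coordinates. -/
abbrev Shell (k : ℕ) (a b : ℝ) : Type := Icc a b × Sph k

/-- The model with boundary of `[a, b] × S^{n-1}`. -/
abbrev shellModel (k : ℕ) := (𝓡∂ 1).prod (𝓡 k)

/-- Polar coordinates `(ρ, ω) ↦ ρ ω`. -/
def polar (k : ℕ) (a b : ℝ) (x : Shell k a b) : Eucl k := (x.1 : ℝ) • (x.2 : Eucl k)

lemma norm_polar {k : ℕ} {a b : ℝ} (ha : 0 < a) (x : Shell k a b) :
    ‖polar k a b x‖ = x.1 := by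
  have h : 0 ≤ (x.1 : ℝ) := ha.le.trans x.1.2.1
  simp [polar, norm_smul, abs_of_nonneg h]

lemma polar_injective {k : ℕ} {a b : ℝ} (ha : 0 < a) : Function.Injective (polar k a b) := by
  intro x y h
  have h1 : (x.1 : ℝ) = y.1 := by rw [← norm_polar ha x, ← norm_polar ha y, h]
  have hx : (x.1 : ℝ) ≠ 0 := (ha.trans_le x.1.2.1).ne'
  refine Prod.ext (Subtype.ext h1) (Subtype.ext ?_)
  have h2 : (x.1 : ℝ) • (x.2 : Eucl k) = (x.1 : ℝ) • (y.2 : Eucl k) := by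
    simpa [polar, h1] using h
  exact smul_right_injective _ hx h2

lemma range_polar {k : ℕ} {a b : ℝ} (ha : 0 < a) :
    range (polar k a b) = {p : Eucl k | a ≤ ‖p‖ ∧ ‖p‖ ≤ b} := by
  ext p
  constructor
  · rintro ⟨x, rfl⟩
    rw [mem_ofPred_eq, norm_polar ha x]
    exact x.1.2
  · intro hp
    have h0 : ‖p‖ ≠ 0 := (ha.trans_le hp.1).ne'
    refine ⟨(⟨‖p‖, hp⟩, ⟨‖p‖⁻¹ • p, ?_⟩), ?_⟩
    · simp [norm_smul, h0]
    · simp [polar, smul_smul, h0]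

/-- The Schwarzschild metric on the closed domain `a ≤ |x| ≤ b`. -/
def shellMetric (k : ℕ) (m a b : ℝ) [Fact (a < b)] (x : Shell k a b) :
    TangentSpace (shellModel k) x →L[ℝ] TangentSpace (shellModel k) x →L[ℝ] ℝ :=
  pullbackForm (shellModel k) 𝓘(ℝ, Eucl k) (polar k a b) (schwarzschildForm k m) x

end Schwarzschild

/-! ### Quotients of manifolds by free smooth finite group actions -/

section Quotient

/-- If a group acts smoothly, freely and properly discontinuously on a smooth manifold, then the
quotient is a smooth manifold. -/
theorem isManifold_quotient {E H M G : Type*} [NormedAddCommGroup E] [NormedSpace ℝ E]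
    [TopologicalSpace H] (I : ModelWithCorners ℝ E H) [TopologicalSpace M] [ChartedSpace H M]
    [IsManifold I ∞ M] [Group G] [MulAction G M] [ProperlyDiscontinuousSMul G M]
    [ContinuousConstSMul G M] [IsCancelSMul G M] [T2Space M] [LocallyCompactSpace M]
    (hsm : ∀ a : G, ContMDiff I I ∞ (fun x : M ↦ a • x)) :
    IsManifold I ∞ (MulAction.orbitRel.Quotient G M) := by
  have hq : IsQuotientCoveringMap (Quotient.mk (MulAction.orbitRel G M)) G :=
    isQuotientCoveringMap_quotientMk_of_properlyDiscontinuousSMul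
  have hl : IsLocalHomeomorph (Quotient.mk (MulAction.orbitRel G M)) :=
    hq.isCoveringMap.isLocalHomeomorph
  have hat : ∀ e ∈ atlas H (MulAction.orbitRel.Quotient G M), ∃ y : M,
      e = (hl.localInverseAt y).trans (chartAt H y) := by
    rintro e ⟨q, rfl⟩
    exact ⟨_, rfl⟩
  apply isManifold_of_contDiffOn
  intro e e' he he'
  obtain ⟨y, rfl⟩ := hat e he
  obtain ⟨y', rfl⟩ := hat e' he'
  intro p hp
  obtain ⟨hp1, hp2⟩ := hp
  -- the point of `M` lying over `p`, and its image under the second local inverse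
  set φ := chartAt H y
  set φ' := chartAt H y'
  set s := hl.localInverseAt y
  set s' := hl.localInverseAt y'
  have hsrc : I.symm p ∈ φ.target ∧ φ.symm (I.symm p) ∈ s.target ∧
      s.symm (φ.symm (I.symm p)) ∈ s'.source ∧
      s' (s.symm (φ.symm (I.symm p))) ∈ φ'.source := by
    simpa [OpenPartialHomeomorph.trans_source, OpenPartialHomeomorph.trans_target, and_assoc]
      using hp1
  obtain ⟨h1, h2, h3, h4⟩ := hsrc
  set z : M := φ.symm (I.symm p) with hz
  have hss : (s.symm : M → _) = Quotient.mk (MulAction.orbitRel G M) := hl.localInverseAt_symm _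
  have hss' : (s'.symm : M → _) = Quotient.mk (MulAction.orbitRel G M) := hl.localInverseAt_symm _
  have h3' : (Quotient.mk (MulAction.orbitRel G M) z) ∈ s'.source := by rw [← hss]; exact h3
  -- the deck transformation
  obtain ⟨a, ha⟩ : ∃ a : G, a • z = s' (s.symm z) := by
    have : Quotient.mk (MulAction.orbitRel G M) (s' (s.symm z)) =
        Quotient.mk (MulAction.orbitRel G M) z := by
      rw [← hss', s'.left_inv h3, hss, hss']
    exact Quotient.exact this
  have haz : a • z ∈ s'.target := ha ▸ s'.map_source h3
  have hev : ∀ᶠ w in 𝓝 z, s' (s.symm w) = a • w := by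
    have hc : ContinuousAt (fun w : M ↦ a • w) z := (continuous_const_smul a).continuousAt
    filter_upwards [hc.eventually (s'.open_target.mem_nhds haz)] with w hw
    have : s.symm w = s'.symm (a • w) := by
      rw [hss, hss']
      exact (Quotient.sound ⟨a, rfl⟩ : Quotient.mk (MulAction.orbitRel G M) (a • w) = _).symm
    rw [this, s'.right_inv hw]
  have hφ : ContinuousWithinAt (fun q : E ↦ φ.symm (I.symm q)) (range I) p :=
    ((φ.continuousAt_symm h1).comp I.continuous_symm.continuousAt).continuousWithinAt
  -- the chart representation of the deck transformation is smooth
  have hmain : ContDiffWithinAt ℝ ∞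
      (fun q : E ↦ I (φ' (a • φ.symm (I.symm q)))) (range I) p := by
    have hsymm : ContMDiffWithinAt 𝓘(ℝ, E) I ∞ (fun q : E ↦ φ.symm (I.symm q)) (range I) p := by
      have := contMDiffWithinAt_extChartAt_symm_range (I := I) (n := ∞) y (y := p)
        (by rw [extChartAt_target]; exact ⟨h1, hp2⟩)
      exact this
    have hch : ContMDiffAt I 𝓘(ℝ, E) ∞ (fun w : M ↦ I (φ' w)) (a • z) := by
      have := contMDiffAt_extChartAt' (I := I) (n := ∞) (x := y') (x' := a • z)
        (by rw [ha]; exact h4)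
      exact this
    exact ((hch.comp z (hsm a z)).comp_contMDiffWithinAt p hsymm).contDiffWithinAt
  refine (hmain.mono inter_subset_right).congr_of_eventuallyEq ?_ ?_
  · have := (hφ.mono inter_subset_right : ContinuousWithinAt (fun q : E ↦ φ.symm (I.symm q))
      (I.symm ⁻¹' ((s.trans φ).symm.trans (s'.trans φ')).source ∩ range I) p).eventually hev
    filter_upwards [this] with q hq
    simp only [Function.comp_apply, OpenPartialHomeomorph.coe_trans,
      OpenPartialHomeomorph.coe_trans_symm]
    rw [hq]
  · simp only [Function.comp_apply, OpenPartialHomeomorph.coe_trans,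
      OpenPartialHomeomorph.coe_trans_symm]
    rw [← hz, ha]

end Quotient

/-! ### The doubled domain and its quotient by the antipodal reflection -/

section Doubled

/-- The closed domain `b²/c ≤ |x| ≤ c`, symmetric with respect to the sphere `|x| = b`, in polar
coordinates. -/
def Doubled (k : ℕ) (b c : ℝ) : Type := Shell k (b ^ 2 / c) c

variable (k : ℕ) (b c : ℝ)

instance factDoubled [h : Fact (0 < b ∧ b < c)] : Fact (b ^ 2 / c < c) := by
  obtain ⟨h0, h1⟩ := h.out
  refine ⟨?_⟩
  rw [div_lt_iff₀ (h0.trans h1)]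
  nlinarith

instance : TopologicalSpace (Doubled k b c) := inferInstanceAs (TopologicalSpace (Shell k _ c))
instance : T2Space (Doubled k b c) := inferInstanceAs (T2Space (Shell k _ c))
instance : CompactSpace (Doubled k b c) := inferInstanceAs (CompactSpace (Shell k _ c))

variable [hbc : Fact (0 < b ∧ b < c)]

instance : ChartedSpace (ModelProd (EuclideanHalfSpace 1) (EuclideanSpace ℝ (Fin k)))
    (Doubled k b c) :=
  inferInstanceAs (ChartedSpace (ModelProd (EuclideanHalfSpace 1) (EuclideanSpace ℝ (Fin k)))
    (Shell k (b ^ 2 / c) c))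

instance : IsManifold (shellModel k) ∞ (Doubled k b c) :=
  inferInstanceAs (IsManifold ((𝓡∂ 1).prod (𝓡 k)) ∞ (Shell k (b ^ 2 / c) c))

/-- The antipodal reflection `(ρ, ω) ↦ (b²/ρ, -ω)`: the reflection across the sphere `|x| = b`
composed with the antipodal map. On the sphere `|x| = b` it is the antipodal map. -/
def antipodalReflection (x : Doubled k b c) : Doubled k b c :=
  (⟨b ^ 2 / (x.1 : ℝ), by
    obtain ⟨h0, h1⟩ := hbc.out
    have hc : 0 < c := h0.trans h1
    have hx : 0 < (x.1 : ℝ) := lt_of_lt_of_le (by positivity) x.1.2.1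
    refine ⟨div_le_div_of_nonneg_left (by positivity) hx x.1.2.2, ?_⟩
    rw [div_le_iff₀ hx, mul_comm, ← div_le_iff₀ hc]
    exact x.1.2.1⟩, -x.2)

lemma antipodalReflection_fst (x : Doubled k b c) :
    ((antipodalReflection k b c x).1 : ℝ) = b ^ 2 / x.1 := rfl

lemma antipodalReflection_snd (x : Doubled k b c) :
    (antipodalReflection k b c x).2 = -x.2 := rfl

lemma antipodalReflection_involutive : Function.Involutive (antipodalReflection k b c) := by
  intro x
  have hb : b ≠ 0 := hbc.out.1.ne'
  refine Prod.ext (Subtype.ext ?_) ?_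
  · rw [antipodalReflection_fst, antipodalReflection_fst, div_div_cancel₀ (pow_ne_zero 2 hb)]
  · rw [antipodalReflection_snd, antipodalReflection_snd, neg_neg]

lemma antipodalReflection_ne (x : Doubled k b c) : antipodalReflection k b c x ≠ x := by
  intro h
  have h2 : -x.2 = x.2 := by rw [← antipodalReflection_snd, h]
  exact ne_neg_of_mem_unit_sphere ℝ x.2 h2.symm

lemma contMDiff_antipodalReflection :
    ContMDiff (shellModel k) (shellModel k) ∞ (antipodalReflection k b c) := by
  have h1 : ContMDiff (shellModel k) (𝓡∂ 1) ∞
      (fun x : Doubled k b c ↦ (antipodalReflection k b c x).1) := by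
    have hv : ContMDiff (shellModel k) 𝓘(ℝ, ℝ) ∞ (fun x : Doubled k b c ↦ (x.1 : ℝ)) :=
      contMDiff_subtypeVal_Icc.comp
        (contMDiff_fst : ContMDiff (shellModel k) (𝓡∂ 1) ∞ (Prod.fst : Shell k (b ^ 2 / c) c → _))
    have hd : ContMDiff (shellModel k) 𝓘(ℝ, ℝ) ∞ (fun x : Doubled k b c ↦ b ^ 2 / (x.1 : ℝ)) := by
      intro x
      have hx : (x.1 : ℝ) ≠ 0 := by
        have h0 : 0 < b := hbc.out.1
        have hc : 0 < c := h0.trans hbc.out.2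
        exact (lt_of_lt_of_le (by positivity) x.1.2.1).ne'
      have hdiv : ContDiffAt ℝ ∞ (fun t : ℝ ↦ b ^ 2 / t) (x.1 : ℝ) :=
        contDiffAt_const.div contDiffAt_id hx
      exact ContMDiffAt.comp x hdiv.contMDiffAt (hv x)
    rw [contMDiff_iff_comp_subtypeVal_Icc]
    exact ⟨hd.continuous.subtype_mk _, hd⟩
  have h2 : ContMDiff (shellModel k) (𝓡 k) ∞
      (fun x : Doubled k b c ↦ (antipodalReflection k b c x).2) :=
    (contMDiff_neg_sphere (E := Eucl k) (n := k) (m := ∞)).comp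
      (contMDiff_snd : ContMDiff (shellModel k) (𝓡 k) ∞ (Prod.snd : Shell k (b ^ 2 / c) c → _))
  exact h1.prodMk h2

/-- The group `ℤˣ = {1, -1}` acts by the antipodal reflection. -/
instance : MulAction ℤˣ (Doubled k b c) where
  smul ε x := if ε = 1 then x else antipodalReflection k b c x
  one_smul _ := if_pos rfl
  mul_smul ε δ x := by
    change (if ε * δ = 1 then x else antipodalReflection k b c x) =
      if ε = 1 then (if δ = 1 then x else antipodalReflection k b c x)
      else antipodalReflection k b c (if δ = 1 then x else antipodalReflection k b c x)
    rcases Int.units_eq_one_or ε with rfl | rfl <;> rcases Int.units_eq_one_or δ with rfl | rfl <;>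
      simp [antipodalReflection_involutive k b c x]

lemma neg_one_smul_doubled (x : Doubled k b c) :
    (-1 : ℤˣ) • x = antipodalReflection k b c x := if_neg (by decide)

lemma contMDiff_smul_doubled (ε : ℤˣ) :
    ContMDiff (shellModel k) (shellModel k) ∞ (fun x : Doubled k b c ↦ ε • x) := by
  rcases Int.units_eq_one_or ε with rfl | rfl
  · simp only [one_smul]
    exact contMDiff_id
  · simpa only [neg_one_smul_doubled] using contMDiff_antipodalReflection k b c

instance : ContinuousConstSMul ℤˣ (Doubled k b c) :=
  ⟨fun ε ↦ (contMDiff_smul_doubled k b c ε).continuous⟩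

instance : IsCancelSMul ℤˣ (Doubled k b c) := by
  refine isCancelSMul_iff_eq_one_of_smul_eq.mpr fun ε x h ↦ ?_
  rcases Int.units_eq_one_or ε with rfl | rfl
  · rfl
  · rw [neg_one_smul_doubled] at h
    exact absurd h (antipodalReflection_ne k b c x)

/-- The quotient of `b²/c ≤ |x| ≤ c` by the antipodal reflection, with its smooth structure of a
quotient by a free action. Each half `b ≤ |x| ≤ c`, `b²/c ≤ |x| ≤ b` is a fundamental domain, so
it is the manifold with boundary obtained from either half by identifying antipodal points of the
sphere `|x| = b`. -/
abbrev AntipodalQuotient : Type := MulAction.orbitRel.Quotient ℤˣ (Doubled k b c)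

instance : IsManifold (shellModel k) ∞ (AntipodalQuotient k b c) :=
  isManifold_quotient (shellModel k) (contMDiff_smul_doubled k b c)

instance : T2Space (AntipodalQuotient k b c) :=
  inferInstanceAs (T2Space (Quotient (MulAction.orbitRel ℤˣ (Doubled k b c))))

instance : CompactSpace (AntipodalQuotient k b c) :=
  inferInstanceAs (CompactSpace (Quotient (MulAction.orbitRel ℤˣ (Doubled k b c))))

/-- The projection to the quotient. -/
def antipodalProj (x : Doubled k b c) : AntipodalQuotient k b c := Quotient.mk _ x

/-- The Schwarzschild metric of mass `m` on the closed domain `b²/c ≤ |x| ≤ c`. -/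
def doubledMetric (m : ℝ) (x : Doubled k b c) :
    TangentSpace (shellModel k) x →L[ℝ] TangentSpace (shellModel k) x →L[ℝ] ℝ :=
  shellMetric k m (b ^ 2 / c) c x

end Doubled

end

/-! Notation: n = k + 1, a prime is ρ d/dρ, ρ₀ is the horizon radius, s the area radius, V the
static potential, I the radial integral with I' = s^{k+1} and I(ρ₀) = 0, and λ_c is
`criticalPotential k m c`.

The radial solutions. Everything rests on s' = V s, V' = (k-1)(1-V²)/2 and the first integral
s^{k-1}(1-V²) = 2m. Variation of constants around the static potential gives λ_c = B + V W with B =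
s^{k+1}/(k(k-1)m) and W' = -(k+1)B; then B' + V W' = 0, so λ_c' = V' W. For a radial function and a
radial conformally flat metric the critical equation splits into the coefficients of p ⊗ p and of
⟨·,·⟩ (`Coord.solvesCriticalEquationAt_conformalForm`); for λ_c both are algebraic consequences of
these relations (`solvesCriticalEquationAt_schwarzschildForm`).

Zeros. At the horizon V = 0, so λ_c = B > 0. Outside, (λ_c/V)' = -V'B/V² = -s²/(kV²) ≤ -ρ²/k, so λ_c
is negative far out and vanishes in between (`exists_criticalPotential_eq_zero`). The inversion ρ ↦
ρ₀²/ρ fixes s and changes the signs of V and I, hence turns λ_c into λ_{-c}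
(`criticalPotential_reflection`). For (ii), choose c so that λ_c vanishes on the given sphere, which
is possible because λ_c is affine in c; a zero of λ_{-c} outside the horizon reflects to a zero of
λ_c inside, and symmetrically. For (iii), λ_0 is invariant under the inversion, so it descends to
the quotient and vanishes on both spheres over the boundary.

Transfer to manifolds. Each domain maps to ℝⁿ \ {0} by a local diffeomorphism f (the inclusion or
polar coordinates), and its metric is the pullback by f. In a chart this is a pullback by a map on
the model range, and connection, Ricci curvature, Hessian and Laplacian are natural under such
pullbacks, boundary points included (`Coord.IsPullbackAt`). A chart of the quotient is a chart of
the cover after a local inverse of the projection, so an invariant metric and solution keep their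
coordinate expressions (`isCriticalMetric_quotientForm`). -/

noncomputable section

namespace Coord

/-! ### Bilinear forms: invertibility and smooth pullback -/

section Aux

variable {E E' X : Type*} [NormedAddCommGroup E] [NormedSpace ℝ E]
  [NormedAddCommGroup E'] [NormedSpace ℝ E'] [NormedAddCommGroup X] [NormedSpace ℝ X]

/-- A nondegenerate bilinear form on a finite-dimensional space is invertible as a map to the
dual space. -/
lemma isInvertible_of_nondegenerate [FiniteDimensional ℝ E] (B : E →L[ℝ] E →L[ℝ] ℝ)
    (h : ∀ v, (∀ z, B v z = 0) → v = 0) : B.IsInvertible := by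
  have hinj : Function.Injective (B : E →ₗ[ℝ] E →L[ℝ] ℝ) := by
    rw [← LinearMap.ker_eq_bot, LinearMap.ker_eq_bot']
    intro v hv
    exact h v fun z ↦ by
      have : B v = 0 := hv
      simp [this]
  have hrank : Module.finrank ℝ E = Module.finrank ℝ (E →L[ℝ] ℝ) := by
    rw [← (LinearMap.toContinuousLinearMap : (E →ₗ[ℝ] ℝ) ≃ₗ[ℝ] E →L[ℝ] ℝ).finrank_eq]
    exact (Subspace.dual_finrank_eq (K := ℝ) (V := E)).symm
  refine ⟨(LinearEquiv.ofInjectiveOfFinrankEq (B : E →ₗ[ℝ] E →L[ℝ] ℝ) hinj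
    hrank).toContinuousLinearEquiv, ?_⟩
  ext v
  rfl

/-- Precompose one slot, flip, precompose the other slot, flip back: the compositions are smooth in
both arguments and flips are continuous linear. -/
lemma contDiffWithinAt_bilinearComp {S : Set X} {p : X} {n : WithTop ℕ∞}
    {B : X → E' →L[ℝ] E' →L[ℝ] ℝ} {D : X → E →L[ℝ] E'}
    (hB : ContDiffWithinAt ℝ n B S p) (hD : ContDiffWithinAt ℝ n D S p) :
    ContDiffWithinAt ℝ n (fun x ↦ (B x).bilinearComp (D x) (D x)) S p := by
  have h1 : ContDiffWithinAt ℝ n (fun x ↦ (B x).comp (D x)) S p := hB.clm_comp hD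
  have h2 : ContDiffWithinAt ℝ n (fun x ↦ ((B x).comp (D x)).flip) S p :=
    (ContinuousLinearMap.flipₗᵢ ℝ E E' ℝ).toContinuousLinearEquiv.contDiff.contDiffAt.comp_contDiffWithinAt
      p h1
  exact (ContinuousLinearMap.flipₗᵢ ℝ E E
    ℝ).toContinuousLinearEquiv.contDiff.contDiffAt.comp_contDiffWithinAt p
      (h2.clm_comp hD)

end Aux

/-! ### Christoffel symbols: Koszul formula and smoothness -/

section Christoffel

variable {E : Type*} [NormedAddCommGroup E] [NormedSpace ℝ E]
  {S : Set E} {G : E → E →L[ℝ] E →L[ℝ] ℝ} {p : E}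

/-- The Koszul formula. Invertibility is essential: `ContinuousLinearMap.inverse` is zero on
noninvertible maps. -/
lemma apply_christoffel (hG : (G p).IsInvertible) (v w z : E) :
    G p (christoffel S G p v w) z = (1 / 2) * (fderivWithin ℝ G S p v w z +
      fderivWithin ℝ G S p w v z - fderivWithin ℝ G S p z v w) := by
  obtain ⟨e, he⟩ := hG
  have h1 : ∀ u, G p ((G p).inverse u) = u := by
    intro u
    rw [← he]
    simp
  simp [christoffel, h1]

lemma contDiffWithinAt_christoffel [CompleteSpace E] (hS : UniqueDiffOn ℝ S) (hp : p ∈ S)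
    (hG : ContDiffWithinAt ℝ ∞ G S p) (hi : (G p).IsInvertible) :
    ContDiffWithinAt ℝ ∞ (christoffel S G) S p := by
  have hD : ContDiffWithinAt ℝ ∞ (fderivWithin ℝ G S) S p :=
    hG.fderivWithin_right hS (by simp) hp
  obtain ⟨e, he⟩ := hi
  have hI : ContDiffWithinAt ℝ ∞ (fun q ↦ (G q).inverse) S p := by
    have := contDiffAt_map_inverse (𝕜 := ℝ) (n := ∞) e
    rw [he] at this
    exact this.comp_contDiffWithinAt p hG
  have hF : ContDiffWithinAt ℝ ∞ (fun q ↦ (fderivWithin ℝ G S q).flip) S p :=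
    (ContinuousLinearMap.flipₗᵢ ℝ E E
      (E →L[ℝ] ℝ)).toContinuousLinearEquiv.contDiff.contDiffAt.comp_contDiffWithinAt p hD
  have hT : ContDiffWithinAt ℝ ∞ (fun q ↦ (ContinuousLinearMap.flipₗᵢ ℝ E E ℝ :
      (E →L[ℝ] E →L[ℝ] ℝ) →L[ℝ] E →L[ℝ] E →L[ℝ] ℝ).comp (fderivWithin ℝ G S q).flip) S p :=
    contDiffWithinAt_const.clm_comp hF
  have hC : ContDiffWithinAt ℝ ∞
      (fun q ↦ ContinuousLinearMap.compL ℝ E (E →L[ℝ] ℝ) E (G q).inverse) S p :=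
    (ContinuousLinearMap.compL ℝ E (E →L[ℝ] ℝ) E).contDiff.contDiffAt.comp_contDiffWithinAt p hI
  exact hC.clm_comp (((hD.add hF).sub hT).const_smul (1 / 2 : ℝ))

end Christoffel

/-! ### Naturality of connection, curvature, Hessian and Laplacian under pullback -/

section Pullback

variable {E E' : Type*} [NormedAddCommGroup E] [NormedSpace ℝ E]
  [NormedAddCommGroup E'] [NormedSpace ℝ E']

/-- `G` is the pullback of `G₀` by `Φ` on `S` near `p`, where everything is smooth. -/
structure IsPullbackAt (S : Set E) (G : E → E →L[ℝ] E →L[ℝ] ℝ) (Φ : E → E')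
    (G₀ : E' → E' →L[ℝ] E' →L[ℝ] ℝ) (p : E) : Prop where
  uniqueDiffOn : UniqueDiffOn ℝ S
  mem : p ∈ S
  mem_closure : p ∈ closure (interior S)
  symm : ∀ v w, G₀ (Φ p) v w = G₀ (Φ p) w v
  contDiffWithinAt : ContDiffWithinAt ℝ ∞ Φ S p
  contDiffAt : ContDiffAt ℝ ∞ G₀ (Φ p)
  isInvertible : (fderivWithin ℝ Φ S p).IsInvertible
  isInvertible_form : (G₀ (Φ p)).IsInvertible
  eventuallyEq : G =ᶠ[𝓝[S] p]
    fun q ↦ (G₀ (Φ q)).bilinearComp (fderivWithin ℝ Φ S q) (fderivWithin ℝ Φ S q)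

variable {S : Set E} {G : E → E →L[ℝ] E →L[ℝ] ℝ} {Φ : E → E'}
  {G₀ : E' → E' →L[ℝ] E' →L[ℝ] ℝ} {p : E}

namespace IsPullbackAt

lemma form_eq (h : IsPullbackAt S G Φ G₀ p) (v w : E) :
    G p v w = G₀ (Φ p) (fderivWithin ℝ Φ S p v) (fderivWithin ℝ Φ S p w) := by
  rw [h.eventuallyEq.self_of_nhdsWithin h.mem]
  rfl

lemma isInvertible_pullback (h : IsPullbackAt S G Φ G₀ p) : (G p).IsInvertible := by
  obtain ⟨e, he⟩ := h.isInvertible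
  obtain ⟨B, hB⟩ := h.isInvertible_form
  refine ⟨e.trans (B.trans (e.arrowCongr (ContinuousLinearEquiv.refl ℝ ℝ)).symm), ?_⟩
  ext v w
  rw [h.form_eq, ← he, ← hB]
  rfl

lemma contDiffWithinAt_fderivWithin (h : IsPullbackAt S G Φ G₀ p) :
    ContDiffWithinAt ℝ ∞ (fderivWithin ℝ Φ S) S p :=
  h.contDiffWithinAt.fderivWithin_right h.uniqueDiffOn (by simp) h.mem

lemma contDiffWithinAt_form (h : IsPullbackAt S G Φ G₀ p) : ContDiffWithinAt ℝ ∞ G S p :=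
  (contDiffWithinAt_bilinearComp (h.contDiffAt.comp_contDiffWithinAt p h.contDiffWithinAt)
    h.contDiffWithinAt_fderivWithin).congr_of_eventuallyEq_of_mem h.eventuallyEq h.mem

lemma hasFDerivWithinAt (h : IsPullbackAt S G Φ G₀ p) :
    HasFDerivWithinAt Φ (fderivWithin ℝ Φ S p) S p :=
  (h.contDiffWithinAt.differentiableWithinAt (by simp)).hasFDerivWithinAt

lemma hasFDerivWithinAt_fderivWithin (h : IsPullbackAt S G Φ G₀ p) :
    HasFDerivWithinAt (fderivWithin ℝ Φ S) (fderivWithin ℝ (fderivWithin ℝ Φ S) S p) S p :=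
  (h.contDiffWithinAt_fderivWithin.differentiableWithinAt (by simp)).hasFDerivWithinAt

/-- Product and chain rule for G₀(Φ)(DΦ w, DΦ z). The two terms in D²Φ are the source of the
inhomogeneous term in the law for Christoffel symbols. -/
lemma fderivWithin_form (h : IsPullbackAt S G Φ G₀ p) (v w z : E) :
    let D := fderivWithin ℝ Φ S p
    let D₂ := fderivWithin ℝ (fderivWithin ℝ Φ S) S p
    fderivWithin ℝ G S p v w z = fderivWithin ℝ G₀ univ (Φ p) (D v) (D w) (D z) +
      G₀ (Φ p) (D₂ v w) (D z) + G₀ (Φ p) (D w) (D₂ v z) := by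
  intro D D₂
  have hu := h.uniqueDiffOn p h.mem
  have h1 : HasFDerivWithinAt G (fderivWithin ℝ G S p) S p :=
    (h.contDiffWithinAt_form.differentiableWithinAt (by simp)).hasFDerivWithinAt
  have h2 : HasFDerivWithinAt (fun q ↦ G q w z) _ S p :=
    (h1.clm_apply (hasFDerivWithinAt_const w p S)).clm_apply (hasFDerivWithinAt_const z p S)
  have h3 : HasFDerivWithinAt (fun q ↦ G₀ (Φ q)) _ S p :=
    (h.contDiffAt.differentiableAt (by simp)).hasFDerivAt.comp_hasFDerivWithinAt p
      h.hasFDerivWithinAt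
  have h4 : HasFDerivWithinAt (fun q ↦ G₀ (Φ q) (fderivWithin ℝ Φ S q w)
      (fderivWithin ℝ Φ S q z)) _ S p :=
    (h3.clm_apply (h.hasFDerivWithinAt_fderivWithin.clm_apply
      (hasFDerivWithinAt_const w p S))).clm_apply
      (h.hasFDerivWithinAt_fderivWithin.clm_apply (hasFDerivWithinAt_const z p S))
  have h5 : HasFDerivWithinAt (fun q ↦ G q w z) _ S p :=
    h4.congr_of_eventuallyEq (h.eventuallyEq.mono fun q hq ↦ by simp only [hq]; rfl)
      (by rw [h.eventuallyEq.self_of_nhdsWithin h.mem]; rfl)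
  have h6 := DFunLike.congr_fun (hu.eq h2 h5) v
  simp only [fderivWithin_univ]
  simpa [D, D₂, add_assoc, add_comm, add_left_comm] using h6

/-- The transformation law of the Christoffel symbols. -/
lemma fderivWithin_christoffel_apply (h : IsPullbackAt S G Φ G₀ p) (v w : E) :
    let D := fderivWithin ℝ Φ S p
    D (christoffel S G p v w) = christoffel univ G₀ (Φ p) (D v) (D w) +
      fderivWithin ℝ (fderivWithin ℝ Φ S) S p v w := by
  intro D
  have hsymm := h.symm
  -- Second derivatives within S commute at boundary points too, because p is a limit of interior
  -- points of S.
  have hs : ∀ v w, fderivWithin ℝ (fderivWithin ℝ Φ S) S p v w =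
      fderivWithin ℝ (fderivWithin ℝ Φ S) S p w v := fun v w ↦
    (h.contDiffWithinAt.isSymmSndFDerivWithinAt (by simp; exact WithTop.coe_le_coe.2 le_top) h.uniqueDiffOn
      h.mem_closure h.mem).eq v w
  obtain ⟨e, he⟩ := h.isInvertible
  obtain ⟨B, hB⟩ := h.isInvertible_form
  -- The form G₀ is nondegenerate and D is onto, so it is enough to pair both sides with vectors D z
  -- and compare Koszul formulas.
  have hinj : Function.Injective (G₀ (Φ p)) := by rw [← hB]; exact B.injective
  apply hinj
  ext z'
  obtain ⟨z, rfl⟩ : ∃ z, D z = z' := ⟨e.symm z', by simp [D, ← he]⟩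
  rw [← h.form_eq, apply_christoffel h.isInvertible_pullback, map_add,
    add_apply, apply_christoffel h.isInvertible_form,
    h.fderivWithin_form, h.fderivWithin_form, h.fderivWithin_form]
  -- Of the six terms containing D²Φ four cancel by symmetry; the other two add up to 2 G₀(D²Φ(v,w),
  -- D z).
  rw [hs w v, hs z v, hs z w, hsymm (D w), hsymm (D v) (fderivWithin ℝ (fderivWithin ℝ Φ S) S p w z)]
  simp only [D]
  rw [hsymm (fderivWithin ℝ (fderivWithin ℝ Φ S) S p v z)]
  ring

/-- The transformation law of the curvature. -/
lemma fderivWithin_curvature_apply [CompleteSpace E] [CompleteSpace E'] (hp : p ∈ S)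
    (h : ∀ᶠ q in 𝓝[S] p, IsPullbackAt S G Φ G₀ q) (v w z : E) :
    let D := fderivWithin ℝ Φ S p
    D (curvature S G p v w z) = curvature univ G₀ (Φ p) (D v) (D w) (D z) := by
  intro D
  have h0 : IsPullbackAt S G Φ G₀ p := h.self_of_nhdsWithin hp
  have hu := h0.uniqueDiffOn p hp
  set D₂ := fderivWithin ℝ (fderivWithin ℝ Φ S) S with hD₂
  have hcD₂ : ContDiffWithinAt ℝ ∞ D₂ S p :=
    h0.contDiffWithinAt_fderivWithin.fderivWithin_right h0.uniqueDiffOn (by simp) hp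
  have hs : ∀ v w, D₂ p v w = D₂ p w v := fun v w ↦
    (h0.contDiffWithinAt.isSymmSndFDerivWithinAt (by simp; exact WithTop.coe_le_coe.2 le_top)
      h0.uniqueDiffOn h0.mem_closure hp).eq v w
  have hs₃ : ∀ v w, fderivWithin ℝ D₂ S p v w = fderivWithin ℝ D₂ S p w v := fun v w ↦
    (h0.contDiffWithinAt_fderivWithin.isSymmSndFDerivWithinAt
      (by simp; exact WithTop.coe_le_coe.2 le_top) h0.uniqueDiffOn h0.mem_closure hp).eq v w
  have hdΓ : HasFDerivWithinAt (christoffel S G) (fderivWithin ℝ (christoffel S G) S p) S p :=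
    ((contDiffWithinAt_christoffel h0.uniqueDiffOn hp h0.contDiffWithinAt_form
      h0.isInvertible_pullback).differentiableWithinAt (by simp)).hasFDerivWithinAt
  have hdΓ₀ : HasFDerivAt (christoffel univ G₀)
      (fderivWithin ℝ (christoffel univ G₀) univ (Φ p)) (Φ p) :=
    hasFDerivWithinAt_univ.1 ((contDiffWithinAt_christoffel uniqueDiffOn_univ (mem_univ _)
      h0.contDiffAt.contDiffWithinAt
      h0.isInvertible_form).differentiableWithinAt (by simp)).hasFDerivWithinAt
  have hΓ : ∀ v w, (fderivWithin ℝ Φ S p) (christoffel S G p v w) =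
      christoffel univ G₀ (Φ p) (fderivWithin ℝ Φ S p v) (fderivWithin ℝ Φ S p w) + D₂ p v w :=
    fun v w ↦ h0.fderivWithin_christoffel_apply v w
  -- the transformation law of the Christoffel symbols, differentiated in the direction `z`
  have key : ∀ v w z : E,
      D₂ p z (christoffel S G p v w) + D (fderivWithin ℝ (christoffel S G) S p z v w) =
        fderivWithin ℝ (christoffel univ G₀) univ (Φ p) (D z) (D v) (D w) +
        christoffel univ G₀ (Φ p) (D₂ p z v) (D w) +
        christoffel univ G₀ (Φ p) (D v) (D₂ p z w) + fderivWithin ℝ D₂ S p z v w := by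
    intro v w z
    have hcv := hasFDerivWithinAt_const (𝕜 := ℝ) v p S
    have hcw := hasFDerivWithinAt_const (𝕜 := ℝ) w p S
    have hdD := h0.hasFDerivWithinAt_fderivWithin
    have hdD₂ : HasFDerivWithinAt D₂ (fderivWithin ℝ D₂ S p) S p :=
      (hcD₂.differentiableWithinAt (by simp)).hasFDerivWithinAt
    have e1 := hdD.clm_apply ((hdΓ.clm_apply hcv).clm_apply hcw)
    have e2 := (((hdΓ₀.comp_hasFDerivWithinAt p h0.hasFDerivWithinAt).clm_apply
      (hdD.clm_apply hcv)).clm_apply (hdD.clm_apply hcw)).add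
      ((hdD₂.clm_apply hcv).clm_apply hcw)
    have e3 := HasFDerivWithinAt.congr_of_eventuallyEq e1
      (f₁ := fun q ↦ christoffel univ G₀ (Φ q) (fderivWithin ℝ Φ S q v) (fderivWithin ℝ Φ S q w) +
        D₂ q v w)
      (h.mono fun q hq ↦ (hq.fderivWithin_christoffel_apply v w).symm)
      (h0.fderivWithin_christoffel_apply v w).symm
    have e4 := DFunLike.congr_fun (hu.eq e3 e2) z
    simp only [Function.comp_apply, ContinuousLinearMap.comp_zero, zero_add, add_apply,
      ContinuousLinearMap.comp_apply, ContinuousLinearMap.flip_apply, ← hD₂] at e4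
    rw [add_comm, e4]
    simp only [D]
    abel
  -- Antisymmetrizing in z and v removes D³Φ and the term with D²Φ(z,v); the remaining terms in D²Φ
  -- are absorbed by the quadratic part of the curvature through `hΓ`.
  have k1 := key v w z
  have k2 := key z w v
  simp only [curvature, add_apply, sub_apply, ContinuousLinearMap.flip_apply,
    ContinuousLinearMap.comp_apply, map_add, map_sub]
  simp only [D] at k1 k2 ⊢
  simp only [hΓ, map_add]
  rw [hs z v, hs₃ z v, ← sub_eq_zero] at k1
  rw [← sub_eq_zero] at k2 ⊢
  rw [← sub_eq_zero.2 (k1.trans k2.symm)]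
  abel

/-- The curvature endomorphisms are conjugate by the isomorphism DΦ, and the trace is invariant
under conjugation. -/
lemma ricci_eq [FiniteDimensional ℝ E] [FiniteDimensional ℝ E'] (hp : p ∈ S)
    (h : ∀ᶠ q in 𝓝[S] p, IsPullbackAt S G Φ G₀ q) (v w : E) :
    ricci S G p v w =
      ricci univ G₀ (Φ p) (fderivWithin ℝ Φ S p v) (fderivWithin ℝ Φ S p w) := by
  have : CompleteSpace E := FiniteDimensional.complete ℝ E
  have : CompleteSpace E' := FiniteDimensional.complete ℝ E'
  obtain ⟨e, he⟩ := (h.self_of_nhdsWithin hp).isInvertible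
  rw [ricci, ricci, ← LinearMap.trace_conj' _ e.toLinearEquiv]
  congr 1
  ext z'
  obtain ⟨z, rfl⟩ := e.surjective z'
  have := fderivWithin_curvature_apply hp h v w z
  rw [← he] at this ⊢
  simpa [LinearEquiv.conj_apply] using this

/-- The chain rule produces an extra term dF₀(D²Φ(v,w)), which is exactly cancelled by the
inhomogeneous term of the Christoffel symbols. -/
lemma hessian_eq (hp : p ∈ S)
    (h : ∀ᶠ q in 𝓝[S] p, IsPullbackAt S G Φ G₀ q) {F : E → ℝ} {F₀ : E' → ℝ}
    (hF₀ : ContDiffAt ℝ 2 F₀ (Φ p)) (hF : F =ᶠ[𝓝[S] p] F₀ ∘ Φ) (v w : E) :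
    hessian S G F p v w =
      hessian univ G₀ F₀ (Φ p) (fderivWithin ℝ Φ S p v) (fderivWithin ℝ Φ S p w) := by
  have h0 : IsPullbackAt S G Φ G₀ p := h.self_of_nhdsWithin hp
  have hu := h0.uniqueDiffOn p hp
  have hd : ∀ᶠ q in 𝓝[S] p, fderivWithin ℝ F S q =
      (fderiv ℝ F₀ (Φ q)).comp (fderivWithin ℝ Φ S q) := by
    have hc : ∀ᶠ q in 𝓝[S] p, ContDiffAt ℝ 2 F₀ (Φ q) :=
      h0.contDiffWithinAt.continuousWithinAt.eventually (hF₀.eventually (by simp))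
    filter_upwards [h, eventually_eventually_nhdsWithin.2 hF, hc, self_mem_nhdsWithin]
      with q hq hFq hcq hqS
    have e : HasFDerivWithinAt (F₀ ∘ Φ) _ S q :=
      (hcq.differentiableAt (by simp)).hasFDerivAt.comp_hasFDerivWithinAt q hq.hasFDerivWithinAt
    exact (e.congr_of_eventuallyEq hFq (hFq.self_of_nhdsWithin hqS)).fderivWithin
      (hq.uniqueDiffOn q hqS)
  have hd0 := hd.self_of_nhdsWithin hp
  have hdF₀ : HasFDerivAt (fderiv ℝ F₀) (fderiv ℝ (fderiv ℝ F₀) (Φ p)) (Φ p) :=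
    ((hF₀.fderiv_right (m := 1) (by norm_num)).differentiableAt (by simp)).hasFDerivAt
  have e := ((hdF₀.comp_hasFDerivWithinAt p h0.hasFDerivWithinAt).clm_comp
    h0.hasFDerivWithinAt_fderivWithin).congr_of_eventuallyEq hd hd0
  simp only [hessian, sub_apply, ContinuousLinearMap.comp_apply, e.fderivWithin hu, hd0,
    fderivWithin_univ, ContinuousLinearMap.compL_apply]
  rw [h0.fderivWithin_christoffel_apply]
  simp
  ring

/-- Raising an index commutes with DΦ, so the two Hessian endomorphisms are conjugate and have equal
traces. -/
lemma laplacian_eq [FiniteDimensional ℝ E] [FiniteDimensional ℝ E'] (hp : p ∈ S)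
    (h : ∀ᶠ q in 𝓝[S] p, IsPullbackAt S G Φ G₀ q) {F : E → ℝ} {F₀ : E' → ℝ}
    (hF₀ : ContDiffAt ℝ 2 F₀ (Φ p)) (hF : F =ᶠ[𝓝[S] p] F₀ ∘ Φ) :
    laplacian S G F p = laplacian univ G₀ F₀ (Φ p) := by
  have h0 : IsPullbackAt S G Φ G₀ p := h.self_of_nhdsWithin hp
  obtain ⟨e, he⟩ := h0.isInvertible
  obtain ⟨A, hA⟩ := h0.isInvertible_pullback
  obtain ⟨B, hB⟩ := h0.isInvertible_form
  rw [laplacian, laplacian, ← LinearMap.trace_conj' _ e.toLinearEquiv]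
  congr 1
  ext z'
  obtain ⟨z, rfl⟩ := e.surjective z'
  have key : e (A.symm (hessian S G F p z)) = B.symm (hessian univ G₀ F₀ (Φ p) (e z)) := by
    apply B.injective
    rw [B.apply_symm_apply]
    ext w'
    obtain ⟨w, rfl⟩ := e.surjective w'
    have h1 := hessian_eq hp h hF₀ hF z w
    have h2 := h0.form_eq (A.symm (hessian S G F p z)) w
    rw [← hA, ← hB, ← he] at h2
    rw [← he] at h1
    simp at h2
    exact h2.symm.trans h1
  rw [← hA, ← hB]
  simpa [LinearEquiv.conj_apply] using key

end IsPullbackAt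

end Pullback

/-! ### The critical equation at a point -/

section Equation

variable {E E' : Type*} [NormedAddCommGroup E] [NormedSpace ℝ E]
  [NormedAddCommGroup E'] [NormedSpace ℝ E']

/-- The equation `-(Δ_G F) G + ∇²_G F - F Ric(G) = G` at the point `p`. -/
def SolvesCriticalEquationAt (S : Set E) (G : E → E →L[ℝ] E →L[ℝ] ℝ) (F : E → ℝ) (p : E) : Prop :=
  ∀ v w, -laplacian S G F p * G p v w + hessian S G F p v w - F p * ricci S G p v w = G p v w

lemma SolvesCriticalEquationAt.pullback [FiniteDimensional ℝ E] [FiniteDimensional ℝ E']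
    {S : Set E} {G : E → E →L[ℝ] E →L[ℝ] ℝ} {Φ : E → E'}
    {G₀ : E' → E' →L[ℝ] E' →L[ℝ] ℝ} {p : E} {F : E → ℝ} {F₀ : E' → ℝ}
    (hsol : SolvesCriticalEquationAt univ G₀ F₀ (Φ p)) (hp : p ∈ S)
    (h : ∀ᶠ q in 𝓝[S] p, IsPullbackAt S G Φ G₀ q)
    (hF₀ : ContDiffAt ℝ 2 F₀ (Φ p)) (hF : F =ᶠ[𝓝[S] p] F₀ ∘ Φ) :
    SolvesCriticalEquationAt S G F p := by
  intro v w
  rw [IsPullbackAt.laplacian_eq hp h hF₀ hF, IsPullbackAt.hessian_eq hp h hF₀ hF,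
    IsPullbackAt.ricci_eq hp h, (h.self_of_nhdsWithin hp).form_eq,
    hF.self_of_nhdsWithin hp]
  exact hsol _ _

end Equation

end Coord

namespace Coord

/-! ### Rotationally symmetric conformally flat metrics -/

section Conformal

variable {E : Type*} [NormedAddCommGroup E] [InnerProductSpace ℝ E]

variable (E) in
/-- The inner product as a bilinear form. -/
def flatForm : E →L[ℝ] E →L[ℝ] ℝ := innerSL ℝ

lemma flatForm_apply (v w : E) : flatForm E v w = inner ℝ v w := rfl

/-- The conformally flat form `φ(p) ⟨v, w⟩`. -/
def conformalForm (φ : E → ℝ) (p : E) : E →L[ℝ] E →L[ℝ] ℝ := φ p • flatForm E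

lemma conformalForm_apply (φ : E → ℝ) (p v w : E) :
    conformalForm φ p v w = φ p * inner ℝ v w := by
  simp [conformalForm, flatForm_apply]

lemma isInvertible_conformalForm [FiniteDimensional ℝ E] {φ : E → ℝ} {p : E} (h : φ p ≠ 0) :
    (conformalForm φ p).IsInvertible := by
  refine isInvertible_of_nondegenerate _ fun v hv ↦ ?_
  simpa [conformalForm_apply, h] using hv v

lemma contDiffAt_conformalForm {φ : E → ℝ} {p : E} {n : WithTop ℕ∞} (h : ContDiffAt ℝ n φ p) :
    ContDiffAt ℝ n (conformalForm φ) p :=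
  h.smul contDiffAt_const

variable [FiniteDimensional ℝ E] {φ η F ℓ : E → ℝ} {μ κ : ℝ} {p : E}

/-- The Christoffel symbols of a conformally flat form whose logarithmic factor has gradient
`2 η(p) p`. -/
lemma christoffel_conformalForm (hφ : φ p ≠ 0)
    (hd : HasFDerivAt φ ((2 * φ p * η p) • innerSL ℝ p) p) (v w : E) :
    christoffel univ (conformalForm φ) p v w =
      η p • (inner ℝ p v • w + inner ℝ p w • v - inner ℝ v w • p) := by
  refine ext_inner_right ℝ fun z ↦ ?_
  have h1 : HasFDerivAt (conformalForm φ) _ p := hd.smul_const (flatForm E)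
  have h2 := apply_christoffel (S := univ) (isInvertible_conformalForm hφ) v w z
  rw [conformalForm_apply, fderivWithin_univ, h1.fderiv] at h2
  rw [← mul_right_inj' hφ, h2]
  simp [inner_add_left, inner_sub_left, inner_smul_left, flatForm_apply]
  ring

/-- Gradients of radial functions are multiples of p, so the geometry is encoded in coefficients: ∇φ
= 2φη p, ∇η = μ p, and for the potential ∇F = ℓ p, ∇ℓ = κ p. Here the product rule is applied to the
explicit Christoffel symbols. -/
lemma fderivWithin_christoffel_conformalForm (hφ : ContDiffAt ℝ ∞ φ p)
    (hφ0 : ∀ᶠ q in 𝓝 p, φ q ≠ 0)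
    (hd : ∀ᶠ q in 𝓝 p, HasFDerivAt φ ((2 * φ q * η q) • innerSL ℝ q) q)
    (hη : HasFDerivAt η (μ • innerSL ℝ p) p) (z v w : E) :
    fderivWithin ℝ (christoffel univ (conformalForm φ)) univ p z v w =
      (μ * inner ℝ p z) • (inner ℝ p v • w + inner ℝ p w • v - inner ℝ v w • p) +
        η p • (inner ℝ z v • w + inner ℝ z w • v - inner ℝ v w • z) := by
  have h1 : HasFDerivAt (christoffel univ (conformalForm φ))
      (fderivWithin ℝ (christoffel univ (conformalForm φ)) univ p) p :=
    hasFDerivWithinAt_univ.1 ((contDiffWithinAt_christoffel uniqueDiffOn_univ (mem_univ _)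
      (contDiffAt_conformalForm hφ).contDiffWithinAt
      (isInvertible_conformalForm hφ0.self_of_nhds)).differentiableWithinAt
        (by simp)).hasFDerivWithinAt
  have h2 := (h1.clm_apply (hasFDerivAt_const v p)).clm_apply (hasFDerivAt_const w p)
  have hin : ∀ u : E, HasFDerivAt (fun q : E ↦ inner ℝ q u) (innerSL ℝ u) p := fun u ↦ by
    simp_rw [real_inner_comm u]
    exact (innerSL ℝ u).hasFDerivAt
  have h3 : HasFDerivAt (fun q ↦ η q • (inner ℝ q v • w + inner ℝ q w • v - inner ℝ v w • q)) _ p :=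
    hη.smul ((((hin v).smul_const w).add ((hin w).smul_const v)).sub
      ((hasFDerivAt_id p).const_smul (inner ℝ v w)))
  have h4 := DFunLike.congr_fun (h2.unique (h3.congr_of_eventuallyEq
    ((hφ0.and hd).mono fun q hq ↦ christoffel_conformalForm hq.1 hq.2 v w))) z
  simp [-fderivWithin_univ] at h4
  rw [h4, real_inner_comm v z, real_inner_comm w z]
  abel

lemma trace_innerSL_smulRight (x y : E) :
    LinearMap.trace ℝ E ((innerSL ℝ x).smulRight y).toLinearMap = inner ℝ x y :=
  LinearMap.trace_smulRight (innerSL ℝ x).toLinearMap y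

/-- The Ricci curvature of a conformally flat, rotationally symmetric form. -/
lemma ricci_conformalForm (hφ : ContDiffAt ℝ ∞ φ p)
    (hφ0 : ∀ᶠ q in 𝓝 p, φ q ≠ 0)
    (hd : ∀ᶠ q in 𝓝 p, HasFDerivAt φ ((2 * φ q * η q) • innerSL ℝ q) q)
    (hη : HasFDerivAt η (μ • innerSL ℝ p) p) (v w : E) :
    let n : ℝ := Module.finrank ℝ E
    ricci univ (conformalForm φ) p v w =
      (n - 2) * (η p ^ 2 - μ) * (inner ℝ p v * inner ℝ p w) -
        (μ * ‖p‖ ^ 2 + 2 * (n - 1) * η p + (n - 2) * η p ^ 2 * ‖p‖ ^ 2) * inner ℝ v w := by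
  intro n
  have hΓ := fun v w ↦ christoffel_conformalForm hφ0.self_of_nhds hd.self_of_nhds v w
  have hdΓ := fun z v w ↦ fderivWithin_christoffel_conformalForm hφ hφ0 hd hη z v w
  set a : ℝ := inner ℝ p v with ha
  set b : ℝ := inner ℝ p w with hb
  set c : ℝ := inner ℝ v w with hc
  set X : E := a • w + b • v - c • p with hX
  -- Sorting the curvature endomorphism into rank-one maps and multiples of the identity makes its
  -- trace readable term by term.
  have hcurv : curvature univ (conformalForm φ) p v w =
      (innerSL ℝ p).smulRight (μ • X)
      + ((innerSL ℝ v).smulRight (η p • w) + (innerSL ℝ w).smulRight (η p • v)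
        - (η p * c) • ContinuousLinearMap.id ℝ E)
      - ((innerSL ℝ p).smulRight ((μ * a) • w) + (μ * a * b) • ContinuousLinearMap.id ℝ E
        - (innerSL ℝ w).smulRight ((μ * a) • p))
      - ((innerSL ℝ v).smulRight (η p • w) + (η p * c) • ContinuousLinearMap.id ℝ E
        - (innerSL ℝ w).smulRight (η p • v))
      + ((innerSL ℝ p).smulRight (η p ^ 2 • X) + (η p ^ 2 * inner ℝ p X) •
        ContinuousLinearMap.id ℝ E - (innerSL ℝ X).smulRight (η p ^ 2 • p))
      - (η p ^ 2) • ((innerSL ℝ p).smulRight (a • w) + (a * b) • ContinuousLinearMap.id ℝ E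
        - (innerSL ℝ w).smulRight (a • p)
        + (innerSL ℝ p).smulRight ((2 * b) • v) - (innerSL ℝ w).smulRight (‖p‖ ^ 2 • v)
        - (innerSL ℝ p).smulRight (c • p) - (innerSL ℝ v).smulRight (b • p)
        + (innerSL ℝ w).smulRight (a • p)) := by
    ext z
    simp only [curvature, add_apply, sub_apply, ContinuousLinearMap.flip_apply,
      ContinuousLinearMap.comp_apply, hΓ, hdΓ, ContinuousLinearMap.smulRight_apply, smul_apply,
      innerSL_apply_apply, ContinuousLinearMap.id_apply, ← ha, ← hb, ← hc, ← hX]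
    simp only [hX, inner_add_left, inner_sub_left, inner_smul_left, inner_add_right,
      inner_sub_right, inner_smul_right, ← ha, ← hb, ← hc, real_inner_comm p v, real_inner_self_eq_norm_sq]
    rw [real_inner_comm v z, real_inner_comm w z, real_inner_comm p z]
    simp
    module
  rw [ricci, hcurv]
  simp only [ContinuousLinearMap.toLinearMap_add, ContinuousLinearMap.toLinearMap_sub,
    ContinuousLinearMap.toLinearMap_smul, map_add, map_sub, map_smul, trace_innerSL_smulRight,
    ContinuousLinearMap.coe_id, LinearMap.trace_id, smul_eq_mul, inner_smul_right]
  simp only [hX, inner_add_left,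
    inner_sub_left, inner_smul_left, inner_add_right, inner_sub_right, inner_smul_right,
    ← ha, ← hb, ← hc, real_inner_comm p v, real_inner_comm p w, real_inner_comm v w,
    real_inner_self_eq_norm_sq, conj_trivial]
  ring

/-- The flat Hessian is ℓ⟨·,·⟩ + κ p ⊗ p, and dF of the Christoffel symbols is ℓη(2 p ⊗ p -
‖p‖²⟨·,·⟩). -/
lemma hessian_conformalForm (hφ0 : φ p ≠ 0)
    (hd : HasFDerivAt φ ((2 * φ p * η p) • innerSL ℝ p) p)
    (hF : ∀ᶠ q in 𝓝 p, HasFDerivAt F (ℓ q • innerSL ℝ q) q)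
    (hℓ : HasFDerivAt ℓ (κ • innerSL ℝ p) p) (v w : E) :
    hessian univ (conformalForm φ) F p v w =
      (ℓ p + ℓ p * η p * ‖p‖ ^ 2) * inner ℝ v w +
        (κ - 2 * ℓ p * η p) * (inner ℝ p v * inner ℝ p w) := by
  have h1 : fderiv ℝ F =ᶠ[𝓝 p] fun q ↦ ℓ q • flatForm E q := hF.mono fun q hq ↦ hq.fderiv
  have h2 : HasFDerivAt (fderiv ℝ F) _ p :=
    (hℓ.smul (flatForm E).hasFDerivAt).congr_of_eventuallyEq h1
  simp only [hessian, fderivWithin_univ, h2.fderiv, h1.self_of_nhds, sub_apply,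
    ContinuousLinearMap.comp_apply, ContinuousLinearMap.compL_apply,
    christoffel_conformalForm hφ0 hd]
  simp [flatForm_apply, inner_add_right, inner_sub_right, inner_smul_right]
  ring

/-- Raising an index divides by φ, hence the factor φ on the left; what remains is the Euclidean
trace of the Hessian. -/
lemma laplacian_conformalForm (hφ0 : φ p ≠ 0)
    (hd : HasFDerivAt φ ((2 * φ p * η p) • innerSL ℝ p) p)
    (hF : ∀ᶠ q in 𝓝 p, HasFDerivAt F (ℓ q • innerSL ℝ q) q)
    (hℓ : HasFDerivAt ℓ (κ • innerSL ℝ p) p) :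
    laplacian univ (conformalForm φ) F p * φ p =
      Module.finrank ℝ E * (ℓ p + ℓ p * η p * ‖p‖ ^ 2) + (κ - 2 * ℓ p * η p) * ‖p‖ ^ 2 := by
  obtain ⟨B, hB⟩ := isInvertible_conformalForm hφ0
  have key : φ p • (conformalForm φ p).inverse.comp (hessian univ (conformalForm φ) F p) =
      (ℓ p + ℓ p * η p * ‖p‖ ^ 2) • ContinuousLinearMap.id ℝ E +
        (κ - 2 * ℓ p * η p) • (innerSL ℝ p).smulRight p := by
    ext v
    refine ext_inner_right ℝ fun w ↦ ?_
    have h1 : conformalForm φ p ((conformalForm φ p).inverse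
        (hessian univ (conformalForm φ) F p v)) = hessian univ (conformalForm φ) F p v := by
      rw [← hB]
      simp
    have h2 := DFunLike.congr_fun h1 w
    rw [conformalForm_apply, hessian_conformalForm hφ0 hd hF hℓ] at h2
    simpa [inner_add_left, inner_smul_left] using h2
  rw [laplacian, mul_comm, ← smul_eq_mul, ← map_smul, ← ContinuousLinearMap.toLinearMap_smul, key]
  simp
  ring

/-- A rotationally symmetric function solves the critical equation of a rotationally symmetric
conformally flat form if two scalar identities hold. -/
lemma solvesCriticalEquationAt_conformalForm (hφ : ContDiffAt ℝ ∞ φ p)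
    (hφ0 : ∀ᶠ q in 𝓝 p, φ q ≠ 0)
    (hd : ∀ᶠ q in 𝓝 p, HasFDerivAt φ ((2 * φ q * η q) • innerSL ℝ q) q)
    (hη : HasFDerivAt η (μ • innerSL ℝ p) p)
    (hF : ∀ᶠ q in 𝓝 p, HasFDerivAt F (ℓ q • innerSL ℝ q) q)
    (hℓ : HasFDerivAt ℓ (κ • innerSL ℝ p) p)
    (h1 : κ - 2 * ℓ p * η p + F p * ((Module.finrank ℝ E : ℝ) - 2) * (μ - η p ^ 2) = 0)
    (h2 : -(Module.finrank ℝ E * (ℓ p + ℓ p * η p * ‖p‖ ^ 2) +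
        (κ - 2 * ℓ p * η p) * ‖p‖ ^ 2) + (ℓ p + ℓ p * η p * ‖p‖ ^ 2) +
        F p * (μ * ‖p‖ ^ 2 + 2 * ((Module.finrank ℝ E : ℝ) - 1) * η p +
          ((Module.finrank ℝ E : ℝ) - 2) * η p ^ 2 * ‖p‖ ^ 2) = φ p) :
    SolvesCriticalEquationAt univ (conformalForm φ) F p := by
  intro v w
  have h3 := laplacian_conformalForm hφ0.self_of_nhds hd.self_of_nhds hF hℓ
  rw [hessian_conformalForm hφ0.self_of_nhds hd.self_of_nhds hF hℓ,
    ricci_conformalForm hφ hφ0 hd hη, conformalForm_apply, ← mul_assoc, neg_mul, h3]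
  -- All terms are combinations of p ⊗ p and ⟨·,·⟩: `h1` is the first coefficient and `h2` the
  -- second.
  linear_combination (inner ℝ p v * inner ℝ p w) * h1 + inner ℝ v w * h2

end Conformal
end Coord

/-! ### Radial calculus and the radial solutions -/

section RadialFunctions

/-- The conformal factor `(1 + m / (2 ρ^{n-2}))^{4/(n-2)}`. -/
def conformalFactor (k : ℕ) (m ρ : ℝ) : ℝ := (1 + m / (2 * ρ ^ (k - 1))) ^ ((4 : ℝ) / ((k : ℝ) - 1))

/-- The static potential `(1 - m / (2 ρ^{n-2})) / (1 + m / (2 ρ^{n-2}))`. -/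
def staticPotential (k : ℕ) (m ρ : ℝ) : ℝ :=
  (1 - m / (2 * ρ ^ (k - 1))) / (1 + m / (2 * ρ ^ (k - 1)))

/-- The integral of `s(t)^n` with respect to `dt / t` from the horizon, `s` being the area
radius. -/
def radialIntegral (k : ℕ) (m ρ : ℝ) : ℝ :=
  ∫ t in horizonRadius k m..ρ, areaRadius k m t ^ (k + 1) / t

/-- The coefficient of the static potential in the radial solutions of the critical equation. -/
def potentialCoeff (k : ℕ) (m c ρ : ℝ) : ℝ :=
  (c - (k + 1) * radialIntegral k m ρ) / (k * (k - 1) * m)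

/-- The radial solutions of the critical equation. -/
def criticalPotential (k : ℕ) (m c ρ : ℝ) : ℝ :=
  areaRadius k m ρ ^ (k + 1) / (k * (k - 1) * m) + staticPotential k m ρ * potentialCoeff k m c ρ

variable {k : ℕ} {m ρ : ℝ}

lemma one_lt_one_add_div (hm : 0 < m) (hρ : 0 < ρ) : 1 < 1 + m / (2 * ρ ^ (k - 1)) := by
  have : 0 < m / (2 * ρ ^ (k - 1)) := by positivity
  linarith

lemma areaRadius_pos (hm : 0 < m) (hρ : 0 < ρ) : 0 < areaRadius k m ρ :=
  mul_pos hρ (Real.rpow_pos_of_pos (zero_lt_one.trans (one_lt_one_add_div hm hρ)) _)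

lemma conformalFactor_pos (hm : 0 < m) (hρ : 0 < ρ) : 0 < conformalFactor k m ρ :=
  Real.rpow_pos_of_pos (zero_lt_one.trans (one_lt_one_add_div hm hρ)) _

lemma areaRadius_sq (hm : 0 < m) (hρ : 0 < ρ) :
    areaRadius k m ρ ^ 2 = ρ ^ 2 * conformalFactor k m ρ := by
  have hu := zero_lt_one.trans (one_lt_one_add_div (k := k) hm hρ)
  rw [areaRadius, conformalFactor, mul_pow, ← Real.rpow_natCast, ← Real.rpow_natCast,
    ← Real.rpow_mul hu.le]
  congr 2
  push_cast
  ring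

lemma natCast_sub_one_pos (hk : 2 ≤ k) : (0 : ℝ) < (k : ℝ) - 1 := by
  have : (2 : ℝ) ≤ k := by exact_mod_cast hk
  linarith

lemma natCast_sub_one (hk : 2 ≤ k) : ((k - 1 : ℕ) : ℝ) = (k : ℝ) - 1 := by
  rw [Nat.cast_sub (by omega), Nat.cast_one]

lemma areaRadius_pow (hk : 2 ≤ k) (hm : 0 < m) (hρ : 0 < ρ) :
    areaRadius k m ρ ^ (k - 1) = ρ ^ (k - 1) * (1 + m / (2 * ρ ^ (k - 1))) ^ 2 := by
  have hu := zero_lt_one.trans (one_lt_one_add_div (k := k) hm hρ)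
  rw [areaRadius, mul_pow, ← Real.rpow_natCast (_ ^ _) (k - 1), ← Real.rpow_mul hu.le,
    natCast_sub_one hk, div_mul_cancel₀ _ (natCast_sub_one_pos hk).ne', Real.rpow_ofNat]

/-- This is the familiar V² = 1 - 2m/s^{n-2} in the area radius: with u = 1 + m/(2ρ^{k-1}) one has
s^{k-1} = ρ^{k-1}u² and 1 - V² = 2m/(ρ^{k-1}u²). -/
lemma areaRadius_pow_mul (hk : 2 ≤ k) (hm : 0 < m) (hρ : 0 < ρ) :
    areaRadius k m ρ ^ (k - 1) * (1 - staticPotential k m ρ ^ 2) = 2 * m := by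
  have hu := zero_lt_one.trans (one_lt_one_add_div (k := k) hm hρ)
  rw [areaRadius_pow hk hm hρ, staticPotential]
  have : ρ ^ (k - 1) ≠ 0 := by positivity
  field_simp
  ring

lemma hasDerivAt_div_pow (hk : 2 ≤ k) (hρ : 0 < ρ) :
    HasDerivAt (fun t ↦ m / (2 * t ^ (k - 1)))
      (-((k - 1) * (m / (2 * ρ ^ (k - 1))) / ρ)) ρ := by
  obtain ⟨j, rfl⟩ : ∃ j, k = j + 2 := ⟨k - 2, by omega⟩
  have hd : HasDerivAt (fun t : ℝ ↦ 2 * t ^ (j + 1)) (2 * (((j + 1 : ℕ) : ℝ) * ρ ^ j)) ρ := by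
    simpa using (hasDerivAt_pow (j + 1) ρ).const_mul 2
  refine ((hasDerivAt_const ρ m).div hd (by positivity)).congr_deriv ?_
  have h1 : j + 2 - 1 = j + 1 := rfl
  rw [h1]
  push_cast
  field_simp
  ring

/-- The static potential is the derivative of log s with respect to log ρ. All radial derivatives
below are likewise kept as a derivative in log ρ, divided by ρ. -/
lemma hasDerivAt_areaRadius (hk : 2 ≤ k) (hm : 0 < m) (hρ : 0 < ρ) :
    HasDerivAt (areaRadius k m) (staticPotential k m ρ * areaRadius k m ρ / ρ) ρ := by
  have hu := zero_lt_one.trans (one_lt_one_add_div (k := k) hm hρ)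
  have h1 := ((hasDerivAt_div_pow (m := m) hk hρ).const_add 1).rpow_const
    (p := (2 : ℝ) / ((k : ℝ) - 1)) (Or.inl hu.ne')
  refine ((hasDerivAt_id ρ).mul h1).congr_deriv ?_
  rw [Real.rpow_sub_one hu.ne', staticPotential, areaRadius]
  have := natCast_sub_one_pos hk
  simp only [id]
  field_simp
  ring

lemma hasDerivAt_staticPotential (hk : 2 ≤ k) (hm : 0 < m) (hρ : 0 < ρ) :
    HasDerivAt (staticPotential k m)
      ((k - 1) * (1 - staticPotential k m ρ ^ 2) / 2 / ρ) ρ := by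
  have hu := zero_lt_one.trans (one_lt_one_add_div (k := k) hm hρ)
  have h1 := hasDerivAt_div_pow (m := m) hk hρ
  refine ((h1.const_sub 1).div (h1.const_add 1) hu.ne').congr_deriv ?_
  rw [staticPotential]
  field_simp
  ring

lemma continuousOn_areaRadius_pow_div (hk : 2 ≤ k) (hm : 0 < m) :
    ContinuousOn (fun t ↦ areaRadius k m t ^ (k + 1) / t) (Ioi 0) := fun _ ht ↦
  (((hasDerivAt_areaRadius hk hm ht).continuousAt.pow (k + 1)).div continuousAt_id
    (ne_of_gt ht)).continuousWithinAt

lemma hasDerivAt_radialIntegral (hk : 2 ≤ k) (hm : 0 < m) (hρ : 0 < ρ) :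
    HasDerivAt (radialIntegral k m) (areaRadius k m ρ ^ (k + 1) / ρ) ρ := by
  have hc := continuousOn_areaRadius_pow_div hk hm
  have hr := horizonRadius_pos k hm
  refine intervalIntegral.integral_hasDerivAt_right ?_ ?_
    (hc.continuousAt (Ioi_mem_nhds hρ))
  · exact (hc.mono fun _ ht ↦ lt_of_lt_of_le (lt_min hr hρ) ht.1).intervalIntegrable
  · exact hc.stronglyMeasurableAtFilter isOpen_Ioi ρ hρ

lemma hasDerivAt_potentialCoeff (hk : 2 ≤ k) (hm : 0 < m) (c : ℝ) (hρ : 0 < ρ) :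
    HasDerivAt (potentialCoeff k m c)
      (-((k + 1) * areaRadius k m ρ ^ (k + 1) / (k * (k - 1) * m)) / ρ) ρ := by
  refine ((((hasDerivAt_radialIntegral hk hm hρ).const_mul ((k : ℝ) + 1)).const_sub c).div_const
    (k * (k - 1) * m : ℝ)).congr_deriv ?_
  ring

lemma hasDerivAt_areaRadius_pow (hk : 2 ≤ k) (hm : 0 < m) (hρ : 0 < ρ) :
    HasDerivAt (fun t ↦ areaRadius k m t ^ (k + 1))
      ((k + 1) * staticPotential k m ρ * areaRadius k m ρ ^ (k + 1) / ρ) ρ := by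
  refine ((hasDerivAt_areaRadius hk hm hρ).pow (k + 1)).congr_deriv ?_
  push_cast
  ring

/-- Variation of constants: the derivative of the coefficient times V cancels the derivative of the
first summand, leaving V' times the coefficient. -/
lemma hasDerivAt_criticalPotential (hk : 2 ≤ k) (hm : 0 < m) (c : ℝ) (hρ : 0 < ρ) :
    HasDerivAt (criticalPotential k m c)
      ((k - 1) * (1 - staticPotential k m ρ ^ 2) / 2 * potentialCoeff k m c ρ / ρ) ρ := by
  refine (((hasDerivAt_areaRadius_pow hk hm hρ).div_const (k * (k - 1) * m : ℝ)).add
    ((hasDerivAt_staticPotential hk hm hρ).mul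
      (hasDerivAt_potentialCoeff hk hm c hρ))).congr_deriv ?_
  ring

lemma hasDerivAt_conformalFactor (hk : 2 ≤ k) (hm : 0 < m) (hρ : 0 < ρ) :
    HasDerivAt (conformalFactor k m)
      (2 * conformalFactor k m ρ * (staticPotential k m ρ - 1) / ρ) ρ := by
  have hu := zero_lt_one.trans (one_lt_one_add_div (k := k) hm hρ)
  have h1 := ((hasDerivAt_div_pow (m := m) hk hρ).const_add 1).rpow_const
    (p := (4 : ℝ) / ((k : ℝ) - 1)) (Or.inl hu.ne')
  refine h1.congr_deriv ?_
  rw [Real.rpow_sub_one hu.ne', staticPotential, conformalFactor]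
  have := natCast_sub_one_pos hk
  field_simp
  ring

/-- The identity V'B = s²/k, which follows from s^{k-1}(1-V²) = 2m and explains the normalization
k(k-1)m of the solutions. -/
lemma areaRadius_pow_mul_eq (hk : 2 ≤ k) (hm : 0 < m) (hρ : 0 < ρ) :
    (k - 1) * (1 - staticPotential k m ρ ^ 2) / 2 *
      (areaRadius k m ρ ^ (k + 1) / (k * (k - 1) * m)) = areaRadius k m ρ ^ 2 / k := by
  have h1 := areaRadius_pow_mul hk hm hρ
  have h2 : areaRadius k m ρ ^ (k + 1) = areaRadius k m ρ ^ (k - 1) * areaRadius k m ρ ^ 2 := by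
    rw [← pow_add]
    congr 1
    omega
  have h3 := natCast_sub_one_pos hk
  have h4 : (0 : ℝ) < k := by linarith
  rw [h2]
  field_simp
  linear_combination areaRadius k m ρ ^ 2 * h1

/-! ### Smoothness -/

lemma contDiffAt_one_add_div {n : WithTop ℕ∞} (hρ : 0 < ρ) :
    ContDiffAt ℝ n (fun t : ℝ ↦ 1 + m / (2 * t ^ (k - 1))) ρ :=
  contDiffAt_const.add (contDiffAt_const.div (contDiffAt_const.mul (contDiffAt_id.pow _))
    (by positivity))

lemma contDiffAt_conformalFactor {n : WithTop ℕ∞} (hm : 0 < m) (hρ : 0 < ρ) :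
    ContDiffAt ℝ n (conformalFactor k m) ρ :=
  (contDiffAt_one_add_div hρ).rpow_const_of_ne
    (zero_lt_one.trans (one_lt_one_add_div (k := k) hm hρ)).ne'

lemma contDiffAt_areaRadius {n : WithTop ℕ∞} (hm : 0 < m) (hρ : 0 < ρ) :
    ContDiffAt ℝ n (areaRadius k m) ρ :=
  contDiffAt_id.mul ((contDiffAt_one_add_div hρ).rpow_const_of_ne
    (zero_lt_one.trans (one_lt_one_add_div (k := k) hm hρ)).ne')

lemma contDiffAt_staticPotential {n : WithTop ℕ∞} (hm : 0 < m) (hρ : 0 < ρ) :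
    ContDiffAt ℝ n (staticPotential k m) ρ := by
  have h : ContDiffAt ℝ n (fun t : ℝ ↦ m / (2 * t ^ (k - 1))) ρ :=
    contDiffAt_const.div (contDiffAt_const.mul (contDiffAt_id.pow _))
      (by positivity)
  exact (contDiffAt_const.sub h).div (contDiffAt_const.add h)
    (zero_lt_one.trans (one_lt_one_add_div (k := k) hm hρ)).ne'

lemma contDiffAt_radialIntegral (hk : 2 ≤ k) (hm : 0 < m) (hρ : 0 < ρ) :
    ContDiffAt ℝ ∞ (radialIntegral k m) ρ := by
  have h : ContDiffOn ℝ ∞ (radialIntegral k m) (Ioi 0) := by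
    rw [contDiffOn_infty_iff_deriv_of_isOpen isOpen_Ioi]
    refine ⟨fun t ht ↦
      (hasDerivAt_radialIntegral hk hm ht).differentiableAt.differentiableWithinAt, ?_⟩
    have h1 : ContDiffOn ℝ ∞ (fun t ↦ areaRadius k m t ^ (k + 1) / t) (Ioi 0) := fun t ht ↦
      (((contDiffAt_areaRadius hm ht).pow _).div contDiffAt_id (ne_of_gt ht)).contDiffWithinAt
    exact h1.congr fun t ht ↦ (hasDerivAt_radialIntegral hk hm ht).deriv
  exact h.contDiffAt (Ioi_mem_nhds hρ)

lemma contDiffAt_criticalPotential (hk : 2 ≤ k) (hm : 0 < m) (c : ℝ) (hρ : 0 < ρ) :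
    ContDiffAt ℝ ∞ (criticalPotential k m c) ρ :=
  (((contDiffAt_areaRadius hm hρ).pow _).div_const _).add
    ((contDiffAt_staticPotential hm hρ).mul
      ((contDiffAt_const.sub (contDiffAt_const.mul
        (contDiffAt_radialIntegral hk hm hρ))).div_const _))

/-! ### Reflection across the horizon and zeros -/

lemma horizonRadius_pow (hk : 2 ≤ k) (hm : 0 < m) : horizonRadius k m ^ (k - 1) = m / 2 := by
  rw [horizonRadius, ← Real.rpow_natCast, ← Real.rpow_mul (by positivity), natCast_sub_one hk,
    one_div_mul_cancel (natCast_sub_one_pos hk).ne', Real.rpow_one]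

lemma staticPotential_horizonRadius (hk : 2 ≤ k) (hm : 0 < m) :
    staticPotential k m (horizonRadius k m) = 0 := by
  rw [staticPotential, horizonRadius_pow hk hm]
  field_simp
  simp

lemma staticPotential_pos (hk : 2 ≤ k) (hm : 0 < m) (hρ : horizonRadius k m < ρ) :
    0 < staticPotential k m ρ := by
  have h0 := horizonRadius_pos k hm
  have h1 : m / 2 < ρ ^ (k - 1) := by
    rw [← horizonRadius_pow hk hm]
    exact pow_lt_pow_left₀ hρ h0.le (by omega)
  have hρ0 := h0.trans hρ
  refine div_pos ?_ (zero_lt_one.trans (one_lt_one_add_div hm hρ0))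
  rw [sub_pos, div_lt_one (by positivity)]
  linarith

lemma staticPotential_reflection (hk : 2 ≤ k) (hm : 0 < m) (hρ : 0 < ρ) :
    staticPotential k m (horizonRadius k m ^ 2 / ρ) = -staticPotential k m ρ := by
  have h1 : (horizonRadius k m ^ 2 / ρ) ^ (k - 1) = m ^ 2 / (4 * ρ ^ (k - 1)) := by
    rw [div_pow, ← pow_mul, mul_comm, pow_mul, horizonRadius_pow hk hm]
    field_simp
    norm_num
  rw [staticPotential, staticPotential, h1]
  have : 0 < ρ ^ (k - 1) := by positivity
  field_simp
  ring

/-- The relation s^{k-1}(1-V²) = 2m determines s from V², and the inversion only changes the sign of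
V. -/
lemma areaRadius_reflection (hk : 2 ≤ k) (hm : 0 < m) (hρ : 0 < ρ) :
    areaRadius k m (horizonRadius k m ^ 2 / ρ) = areaRadius k m ρ := by
  have hr : 0 < horizonRadius k m ^ 2 / ρ := div_pos (pow_pos (horizonRadius_pos k hm) 2) hρ
  have h1 := areaRadius_pow_mul hk hm hρ
  have h2 := areaRadius_pow_mul hk hm hr
  rw [staticPotential_reflection hk hm hρ, neg_sq] at h2
  have h3 : 1 - staticPotential k m ρ ^ 2 ≠ 0 := by
    intro h
    rw [h] at h1
    linarith
  exact (pow_left_inj₀ (areaRadius_pos hm hr).le (areaRadius_pos hm hρ).le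
    (by omega : k - 1 ≠ 0)).1 (mul_right_cancel₀ h3 (h2.trans h1.symm))

/-- The measure dt/t changes sign under t ↦ ρ₀²/t while s is invariant, so the sum of both sides has
zero derivative; it vanishes at the horizon. -/
lemma radialIntegral_reflection (hk : 2 ≤ k) (hm : 0 < m) (hρ : 0 < ρ) :
    radialIntegral k m (horizonRadius k m ^ 2 / ρ) = -radialIntegral k m ρ := by
  have h0 := horizonRadius_pos k hm
  have hd : ∀ t ∈ Ioi (0 : ℝ), HasDerivAt
      (fun t ↦ radialIntegral k m (horizonRadius k m ^ 2 / t) + radialIntegral k m t) 0 t := by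
    intro t ht
    have ht0 : 0 < t := ht
    have hr : 0 < horizonRadius k m ^ 2 / t := div_pos (pow_pos h0 2) ht
    have h1 : HasDerivAt (fun t ↦ horizonRadius k m ^ 2 / t) (-(horizonRadius k m ^ 2) / t ^ 2) t := by
      refine ((hasDerivAt_const t (horizonRadius k m ^ 2)).div (hasDerivAt_id t)
        ht0.ne').congr_deriv ?_
      simp
    refine (((hasDerivAt_radialIntegral hk hm hr).comp t h1).add
      (hasDerivAt_radialIntegral hk hm ht)).congr_deriv ?_
    rw [areaRadius_reflection hk hm ht]
    field_simp
    ring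
  have h2 := isOpen_Ioi.is_const_of_deriv_eq_zero isPreconnected_Ioi
    (fun t ht ↦ (hd t ht).differentiableAt.differentiableWithinAt)
    (fun t ht ↦ (hd t ht).deriv) (x := ρ) (y := horizonRadius k m) hρ h0
  have h3 : horizonRadius k m ^ 2 / horizonRadius k m = horizonRadius k m := by
    field_simp
  simp only [h3] at h2
  have h4 : radialIntegral k m (horizonRadius k m) = 0 := intervalIntegral.integral_same
  rw [h4] at h2
  linarith

/-- Both V and the integral I are odd, so V(c - (k+1)I) becomes V(-c - (k+1)I), and the first
summand is even. -/
lemma criticalPotential_reflection (hk : 2 ≤ k) (hm : 0 < m) (c : ℝ) (hρ : 0 < ρ) :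
    criticalPotential k m c (horizonRadius k m ^ 2 / ρ) = criticalPotential k m (-c) ρ := by
  rw [criticalPotential, criticalPotential, potentialCoeff, potentialCoeff,
    areaRadius_reflection hk hm hρ, staticPotential_reflection hk hm hρ,
    radialIntegral_reflection hk hm hρ]
  ring

/-- The value at ρ is affine in c with slope V/(k(k-1)m), which is nonzero off the horizon. -/
lemma exists_criticalPotential_eq_zero_at (hk : 2 ≤ k) (hm : 0 < m) (hρ : horizonRadius k m < ρ) :
    ∃ c, criticalPotential k m c ρ = 0 := by
  have hV := staticPotential_pos hk hm hρ
  refine ⟨(k + 1) * radialIntegral k m ρ - areaRadius k m ρ ^ (k + 1) / staticPotential k m ρ, ?_⟩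
  rw [criticalPotential, potentialCoeff]
  field_simp
  ring

/-- Every radial solution of the critical equation vanishes on a sphere outside of the horizon. -/
lemma exists_criticalPotential_eq_zero (hk : 2 ≤ k) (hm : 0 < m) (c : ℝ) :
    ∃ ρ, horizonRadius k m < ρ ∧ criticalPotential k m c ρ = 0 := by
  have hr := horizonRadius_pos k hm
  set r := horizonRadius k m with hr_def
  have hk1 := natCast_sub_one_pos hk
  have hk0 : (0 : ℝ) < k := by linarith
  have h0 : 0 < criticalPotential k m c r := by
    rw [criticalPotential, staticPotential_horizonRadius hk hm]
    have := pow_pos (areaRadius_pos (k := k) hm hr) (k + 1)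
    rw [zero_mul, add_zero]
    positivity
  -- The quotient by V removes the unknown coefficient from the derivative: (λ/V)' = -V'B/V². Since
  -- s ≥ t and V² ≤ 1, λ/V falls at least as fast as -t²/(2k), so `h` is nonincreasing.
  let h : ℝ → ℝ := fun t ↦ criticalPotential k m c t / staticPotential k m t + t ^ 2 / (2 * k)
  have hd : ∀ t, r < t → HasDerivAt h
      (-(areaRadius k m t ^ 2 / (k * t * staticPotential k m t ^ 2)) + t / k) t := by
    intro t ht
    have ht0 := hr.trans ht
    have hV := staticPotential_pos hk hm ht
    have h1 := areaRadius_pow_mul_eq hk hm ht0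
    have h2 := ((hasDerivAt_pow 2 t).div_const (2 * k : ℝ))
    refine (((hasDerivAt_criticalPotential hk hm c ht0).div (hasDerivAt_staticPotential hk hm ht0)
      hV.ne').add h2).congr_deriv ?_
    have h3 : areaRadius k m t ^ 2 / (k * t * staticPotential k m t ^ 2) =
        areaRadius k m t ^ 2 / k / (t * staticPotential k m t ^ 2) := by
      field_simp
    rw [h3, ← h1, criticalPotential]
    field_simp
    ring
  have hdle : ∀ t, r < t →
      -(areaRadius k m t ^ 2 / (k * t * staticPotential k m t ^ 2)) + t / k ≤ 0 := by
    intro t ht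
    have ht0 := hr.trans ht
    have hV := staticPotential_pos hk hm ht
    have hV1 : staticPotential k m t ^ 2 ≤ 1 := by
      have h1 := areaRadius_pow_mul hk hm ht0
      have h2 := pow_pos (areaRadius_pos (k := k) hm ht0) (k - 1)
      by_contra! h3
      nlinarith
    have hs : t ^ 2 ≤ areaRadius k m t ^ 2 := by
      rw [areaRadius_sq hm ht0]
      exact le_mul_of_one_le_right (sq_nonneg t) (Real.one_le_rpow (one_lt_one_add_div hm ht0).le
        (div_nonneg (by norm_num) hk1.le))
    have h4 : t / k ≤ areaRadius k m t ^ 2 / (k * t * staticPotential k m t ^ 2) := by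
      rw [div_le_div_iff₀ hk0 (by positivity)]
      have : t ^ 2 * staticPotential k m t ^ 2 ≤ t ^ 2 := mul_le_of_le_one_right (sq_nonneg t) hV1
      nlinarith
    linarith
  have hanti : AntitoneOn h (Ioi r) := by
    refine antitoneOn_of_deriv_nonpos (convex_Ioi r)
      (fun t ht ↦ (hd t ht).continuousAt.continuousWithinAt) ?_ ?_
    · rw [interior_Ioi]
      exact fun t ht ↦ (hd t ht).differentiableAt.differentiableWithinAt
    · rw [interior_Ioi]
      intro t ht
      rw [(hd t ht).deriv]
      exact hdle t ht
  obtain ⟨R, hR1, hR⟩ : ∃ R, r + 1 ≤ R ∧ h (r + 1) < R ^ 2 / (2 * k) := by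
    -- This R exceeds both 1 and 2k|h(r+1)|, hence R² > R > 2k|h(r+1)|.
    refine ⟨r + 1 + 2 * k * |h (r + 1)|, by linarith [show 0 ≤ 2 * k * |h (r + 1)| by positivity], ?_⟩
    rw [lt_div_iff₀ (by positivity)]
    have h1 : h (r + 1) * (2 * k) ≤ 2 * k * |h (r + 1)| := by
      rw [mul_comm]
      exact mul_le_mul_of_nonneg_left (le_abs_self _) (by positivity)
    have h2 : 0 ≤ 2 * k * |h (r + 1)| := by positivity
    nlinarith
  have hrR : r < R := by linarith
  have hneg : criticalPotential k m c R < 0 := by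
    have h1 : h R ≤ h (r + 1) := hanti (by simp) hrR hR1
    have h2 : criticalPotential k m c R / staticPotential k m R < 0 := by
      have : h R = criticalPotential k m c R / staticPotential k m R + R ^ 2 / (2 * k) := rfl
      linarith
    have hV := staticPotential_pos hk hm hrR
    by_contra! h3
    exact absurd (div_nonneg h3 hV.le) (not_le.2 h2)
  have hcont : ContinuousOn (criticalPotential k m c) (Icc r R) := fun t ht ↦
    (hasDerivAt_criticalPotential hk hm c (hr.trans_le ht.1)).continuousAt.continuousWithinAt
  obtain ⟨t, ht, ht0⟩ := intermediate_value_Icc' hrR.le hcont ⟨hneg.le, h0.le⟩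
  -- The zero is not the horizon itself, where the potential is positive.
  refine ⟨t, lt_of_le_of_ne ht.1 ?_, ht0⟩
  rintro rfl
  exact h0.ne' ht0

end RadialFunctions

/-! ### Gradients of radial functions -/

section Radial

variable {E : Type*} [NormedAddCommGroup E] [InnerProductSpace ℝ E]

/-- The derivative of a rotationally symmetric function. -/
lemma HasDerivAt.hasFDerivAt_comp_norm {f : ℝ → ℝ} {f' : ℝ} {p : E} (hp : p ≠ 0)
    (hf : HasDerivAt f f' ‖p‖) :
    HasFDerivAt (fun q : E ↦ f ‖q‖) ((f' / ‖p‖) • innerSL ℝ p) p := by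
  have hn : 0 < ‖p‖ := norm_pos_iff.2 hp
  have h1 : HasFDerivAt (fun q : E ↦ ‖q‖) (‖p‖⁻¹ • innerSL ℝ p) p := by
    have h2 := (hasStrictFDerivAt_norm_sq p).hasFDerivAt.sqrt (by positivity)
    simp only [Real.sqrt_sq (norm_nonneg _)] at h2
    refine h2.congr_fderiv ?_
    ext v
    simp
    field_simp
  refine (hf.comp_hasFDerivAt p h1).congr_fderiv ?_
  rw [smul_smul, div_eq_mul_inv]

end Radial

/-! ### The critical equation on ℝⁿ \ {0} -/

section SchwarzschildForm

variable {k : ℕ} {m : ℝ}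

lemma schwarzschildForm_eq (k : ℕ) (m : ℝ) :
    schwarzschildForm k m =
      (Coord.conformalForm fun p : Eucl k ↦ conformalFactor k m ‖p‖) := rfl

lemma contDiffAt_conformalFactor_norm (hm : 0 < m) {p : Eucl k} (hp : p ≠ 0) :
    ContDiffAt ℝ ∞ (fun p : Eucl k ↦ conformalFactor k m ‖p‖) p :=
  (contDiffAt_conformalFactor hm (norm_pos_iff.2 hp)).comp p (contDiffAt_norm ℝ hp)

lemma contDiffAt_criticalPotential_norm (hk : 2 ≤ k) (hm : 0 < m) (c : ℝ) {p : Eucl k}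
    (hp : p ≠ 0) : ContDiffAt ℝ ∞ (fun p : Eucl k ↦ criticalPotential k m c ‖p‖) p :=
  (contDiffAt_criticalPotential hk hm c (norm_pos_iff.2 hp)).comp p (contDiffAt_norm ℝ hp)

/-- The radial functions `criticalPotential k m c` solve the critical equation of the
Schwarzschild metric away from the origin. -/
lemma solvesCriticalEquationAt_schwarzschildForm (hk : 2 ≤ k) (hm : 0 < m) (c : ℝ) {p : Eucl k}
    (hp : p ≠ 0) :
    Coord.SolvesCriticalEquationAt univ (schwarzschildForm k m)
      (fun p : Eucl k ↦ criticalPotential k m c ‖p‖) p := by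
  have hne : ∀ᶠ q : Eucl k in 𝓝 p, q ≠ 0 := isOpen_ne.mem_nhds hp
  have hr : 0 < ‖p‖ := norm_pos_iff.2 hp
  set V := staticPotential k m with hV
  set W := potentialCoeff k m c with hW
  set A := areaRadius k m
  -- This is t dV/dt written through V, so that further derivatives again involve only V.
  let dV : ℝ → ℝ := fun t ↦ (k - 1) * (1 - V t ^ 2) / 2
  have hV' : HasDerivAt V (dV ‖p‖ / ‖p‖) ‖p‖ := hasDerivAt_staticPotential hk hm hr
  have hdV : HasDerivAt dV (-((k - 1) * V ‖p‖ * dV ‖p‖ / ‖p‖)) ‖p‖ := by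
    refine ((((hV'.pow 2).const_sub 1).const_mul ((k : ℝ) - 1)).div_const 2).congr_deriv ?_
    ring
  have hW' : HasDerivAt W (-((k + 1) * (A ‖p‖ ^ (k + 1) / (k * (k - 1) * m))) / ‖p‖) ‖p‖ := by
    refine (hasDerivAt_potentialCoeff hk hm c hr).congr_deriv ?_
    ring
  have hη := (HasDerivAt.div (hV'.sub_const 1) (hasDerivAt_pow 2 ‖p‖)
    (by positivity)).hasFDerivAt_comp_norm hp
  have hℓ := (HasDerivAt.div (hdV.mul hW')
    (hasDerivAt_pow 2 ‖p‖) (by positivity)).hasFDerivAt_comp_norm hp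
  rw [schwarzschildForm_eq]
  have hkey := areaRadius_pow_mul_eq hk hm hr
  have hsq := areaRadius_sq (k := k) hm hr
  have hk1 := natCast_sub_one_pos hk
  have hk0 : (0 : ℝ) < k := by linarith
  have hlam : criticalPotential k m c ‖p‖ = A ‖p‖ ^ (k + 1) / (k * (k - 1) * m) + V ‖p‖ * W ‖p‖ :=
    rfl
  refine Coord.solvesCriticalEquationAt_conformalForm
    (η := fun q ↦ (V ‖q‖ - 1) / ‖q‖ ^ 2) (ℓ := fun q ↦ dV ‖q‖ * W ‖q‖ / ‖q‖ ^ 2)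
    (contDiffAt_conformalFactor_norm hm hp)
    (hne.mono fun q hq ↦ (conformalFactor_pos hm (norm_pos_iff.2 hq)).ne')
    (hne.mono fun q hq ↦ ?_) hη (hne.mono fun q hq ↦ ?_) hℓ ?_ ?_
  · refine ((hasDerivAt_conformalFactor hk hm (norm_pos_iff.2 hq)).hasFDerivAt_comp_norm
      hq).congr_fderiv ?_
    have : ‖q‖ ≠ 0 := norm_ne_zero_iff.2 hq
    congr 1
    rw [hV]
    field_simp
  · refine ((hasDerivAt_criticalPotential hk hm c (norm_pos_iff.2 hq)).hasFDerivAt_comp_norm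
      hq).congr_fderiv ?_
    have : ‖q‖ ≠ 0 := norm_ne_zero_iff.2 hq
    congr 1
    simp only [dV, hV, hW]
    field_simp
  · rw [finrank_euclideanSpace_fin, hlam]
    push_cast
    set B := A ‖p‖ ^ (k + 1) / (k * (k - 1) * m)
    simp only [dV, Pi.mul_apply]
    field_simp
    ring
  · rw [finrank_euclideanSpace_fin, hlam]
    push_cast
    -- Since φ = s²/ρ² and s²/k = V'B, the conformal factor is rational in V, B and ρ; the second
    -- identity becomes one of rational functions.
    have hfac : conformalFactor k m ‖p‖ = k * ((k - 1) * (1 - V ‖p‖ ^ 2) / 2 *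
        (A ‖p‖ ^ (k + 1) / (k * (k - 1) * m))) / ‖p‖ ^ 2 := by
      rw [hkey, hsq]
      field_simp
    rw [hfac]
    set B := A ‖p‖ ^ (k + 1) / (k * (k - 1) * m)
    simp only [dV, Pi.mul_apply]
    field_simp
    ring

end SchwarzschildForm

/-! ### From chart expressions to manifolds with boundary -/

section General

variable {E : Type*} [NormedAddCommGroup E] [NormedSpace ℝ E]
  {H : Type*} [TopologicalSpace H] {I : ModelWithCorners ℝ E H}
  {M : Type*} [TopologicalSpace M] [ChartedSpace H M]
  {E' : Type*} [NormedAddCommGroup E'] [NormedSpace ℝ E']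
  {H' : Type*} [TopologicalSpace H'] {I' : ModelWithCorners ℝ E' H'}
  {M' : Type*} [TopologicalSpace M'] [ChartedSpace H' M']

/-- The set of vectors of length less than one for a positive definite form is bounded. -/
lemma isVonNBounded_posDef [FiniteDimensional ℝ E] (B : E →L[ℝ] E →L[ℝ] ℝ)
    (hpos : ∀ v, v ≠ 0 → 0 < B v v) : Bornology.IsVonNBounded ℝ {v : E | B v v < 1} := by
  rw [NormedSpace.isVonNBounded_iff]
  rcases subsingleton_or_nontrivial E with hE | hE
  · exact (Set.subsingleton_of_subsingleton (s := {v : E | B v v < 1})).finite.isBounded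
  have hc : Continuous fun v : E ↦ B v v := by fun_prop
  obtain ⟨v₀, hv₀, hmin⟩ := (isCompact_sphere (0 : E) 1).exists_isMinOn
    (NormedSpace.sphere_nonempty.2 zero_le_one) hc.continuousOn
  have h0 : v₀ ≠ 0 := ne_zero_of_mem_unit_sphere ⟨v₀, hv₀⟩
  have hε := hpos v₀ h0
  set ε := B v₀ v₀
  -- With ε the minimum of the form on the unit sphere, ‖v‖ ≥ ε⁻¹ + 1 forces B v v ≥ ε‖v‖² ≥ 1.
  refine (Metric.isBounded_ball (x := (0 : E)) (r := ε⁻¹ + 1)).subset fun v hv ↦ ?_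
  rw [mem_ball_zero_iff]
  by_contra! hle
  have hε' : 0 < ε⁻¹ := inv_pos.2 hε
  have hn : 0 < ‖v‖ := by linarith
  have h1 : ε ≤ B (‖v‖⁻¹ • v) (‖v‖⁻¹ • v) := hmin (by simp [norm_smul, hn.ne'])
  simp only [map_smul, smul_apply, smul_eq_mul] at h1
  have h2 : B v v < 1 := hv
  have h3 : ε * ‖v‖ ^ 2 ≤ B v v := by
    rw [← mul_assoc, ← mul_inv, inv_mul_eq_div, le_div_iff₀ (by positivity)] at h1
    rwa [sq]
  have h4 : 1 ≤ ε * ‖v‖ ^ 2 := by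
    calc 1 = ε * ε⁻¹ := (mul_inv_cancel₀ hε.ne').symm
      _ ≤ ε * ‖v‖ ^ 2 := by
        apply mul_le_mul_of_nonneg_left _ hε.le
        nlinarith
  linarith

/-- A field of inner products is a smooth Riemannian metric if it is smooth in the charts. -/
lemma isSmoothMetric_of_contDiffWithinAt_metricInChart [IsManifold I ∞ M] [FiniteDimensional ℝ E]
    {g : Π y : M, TangentSpace I y →L[ℝ] TangentSpace I y →L[ℝ] ℝ}
    (hsymm : ∀ (x : M) (v w : TangentSpace I x), g x v w = g x w v)
    (hpos : ∀ (x : M) (v : TangentSpace I x), v ≠ 0 → 0 < g x v v)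
    (hsmooth : ∀ x : M,
      ContDiffWithinAt ℝ ∞ (metricInChart I g x) (range I) (extChartAt I x x)) :
    IsSmoothMetric I g := by
  refine ⟨⟨g, hsymm, hpos, fun x ↦ isVonNBounded_posDef (E := E) (g x) (hpos x), fun x₀ ↦ ?_⟩,
    fun x ↦ rfl⟩
  rw [Bundle.contMDiffAt_section]
  have h1 : ContMDiffAt I 𝓘(ℝ, E →L[ℝ] E →L[ℝ] ℝ) ∞
      (fun x ↦ metricInChart I g x₀ (extChartAt I x₀ x)) x₀ :=
    ContMDiffWithinAt.comp_of_eq (t := range I) (s := univ) (x := x₀)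
      (hsmooth x₀).contMDiffWithinAt (contMDiffAt_extChartAt (x := x₀) (n := ∞))
      (fun x _ ↦ by simp) rfl
  refine h1.congr_of_eventuallyEq ?_
  filter_upwards [(chartAt H x₀).open_source.mem_nhds (mem_chart_source H x₀)] with x hx
  rw [hom_trivializationAt_apply]
  ext v w
  have hb : x ∈ (trivializationAt E (TangentSpace I) x₀).baseSet := by simpa using hx
  change ContinuousLinearMap.inCoordinates E (TangentSpace I) (E →L[ℝ] ℝ)
    (fun x ↦ TangentSpace I x →L[ℝ] Bundle.Trivial M ℝ x) x₀ x x₀ x (g x) v w = _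
  have h2 := TangentBundle.symmL_trivializationAt (𝕜 := ℝ) (I := I) hx
  have hx' : (extChartAt I x₀).symm (extChartAt I x₀ x) = x :=
    (extChartAt I x₀).left_inv (by simpa using hx)
  have h3 : metricInChart I g x₀ (extChartAt I x₀ x) v w =
    g x ((trivializationAt E (TangentSpace I) x₀).symmL ℝ x v)
      ((trivializationAt E (TangentSpace I) x₀).symmL ℝ x w) := by
    -- The base points agree only propositionally, so the forms are compared on the common model
    -- space E.
    have key : ∀ y : M, y = x → ∀ a b : E,
        (show E →L[ℝ] E →L[ℝ] ℝ from g y) a b = (show E →L[ℝ] E →L[ℝ] ℝ from g x) a b := by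
      rintro _ rfl a b
      rfl
    rw [h2]
    exact key _ hx' _ _
  rw [h3, inCoordinates_apply_eq₂ hb hb (by simp)]
  have h4 : ∀ u : E, (trivializationAt E (TangentSpace I) x₀).symmL ℝ x u =
      (trivializationAt E (TangentSpace I) x₀).symm x u := fun u ↦
    (trivializationAt E (TangentSpace I) x₀).symmL_apply hb u
  rw [h4, h4]
  simp

/-- The metric `f^* g` in a chart is the pullback by `f` written in the chart. -/
lemma metricInChart_pullbackForm [IsManifold I ∞ M] {f : M → M'}
    (g : Π y : M', TangentSpace I' y →L[ℝ] TangentSpace I' y →L[ℝ] ℝ)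
    {x : M} {p : E} (hp : p ∈ (extChartAt I x).target)
    (hf : MDifferentiableAt I I' f ((extChartAt I x).symm p)) (v w : E) :
    metricInChart I (pullbackForm I I' f g) x p v w =
      g (f ((extChartAt I x).symm p))
        (mfderivWithin 𝓘(ℝ, E) I' (f ∘ (extChartAt I x).symm) (range I) p v)
        (mfderivWithin 𝓘(ℝ, E) I' (f ∘ (extChartAt I x).symm) (range I) p w) := by
  have h2 : MDifferentiableWithinAt 𝓘(ℝ, E) I (extChartAt I x).symm (range I) p :=
    mdifferentiableWithinAt_extChartAt_symm hp
  have h3 : UniqueMDiffWithinAt 𝓘(ℝ, E) (range I) p :=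
    (I.uniqueDiffOn p (extChartAt_target_subset_range x hp)).uniqueMDiffWithinAt
  rw [mfderiv_comp_mfderivWithin p hf h2 h3]
  rfl

/-- In a chart, the metric `f^* G₀` is the pullback of `G₀` by `f` written in the chart. -/
lemma isPullbackAt_metricInChart [IsManifold I ∞ M] {f : M → E'}
    (hf : ContMDiff I 𝓘(ℝ, E') ∞ f)
    (hinv : ∀ x, (show E →L[ℝ] E' from mfderiv I 𝓘(ℝ, E') f x).IsInvertible)
    {G₀ : E' → E' →L[ℝ] E' →L[ℝ] ℝ} (hG₀ : ∀ x, ContDiffAt ℝ ∞ G₀ (f x))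
    (hsymm : ∀ y v w, G₀ y v w = G₀ y w v) (hG₀inv : ∀ x, (G₀ (f x)).IsInvertible)
    {x : M} {p : E} (hp : p ∈ (extChartAt I x).target) :
    Coord.IsPullbackAt (range I) (metricInChart I (pullbackForm I 𝓘(ℝ, E') f G₀) x)
      (f ∘ (extChartAt I x).symm) G₀ p where
  uniqueDiffOn := I.uniqueDiffOn
  mem := extChartAt_target_subset_range x hp
  mem_closure := I.range_subset_closure_interior (extChartAt_target_subset_range x hp)
  symm := hsymm _
  contDiffWithinAt := ((hf _).comp_contMDiffWithinAt p
    (contMDiffWithinAt_extChartAt_symm_range x hp)).contDiffWithinAt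
  contDiffAt := hG₀ _
  isInvertible := by
    have h2 : MDifferentiableWithinAt 𝓘(ℝ, E) I (extChartAt I x).symm (range I) p :=
      mdifferentiableWithinAt_extChartAt_symm hp
    have h3 : UniqueMDiffWithinAt 𝓘(ℝ, E) (range I) p :=
      (I.uniqueDiffOn p (extChartAt_target_subset_range x hp)).uniqueMDiffWithinAt
    have h4 := mfderiv_comp_mfderivWithin p (hf.mdifferentiable (by simp) _) h2 h3
    rw [mfderivWithin_eq_fderivWithin] at h4
    rw [h4]
    exact (hinv _).comp (isInvertible_mfderivWithin_extChartAt_symm hp)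
  isInvertible_form := hG₀inv _
  eventuallyEq := by
    filter_upwards [extChartAt_target_mem_nhdsWithin_of_mem hp] with q hq
    ext v w
    have := metricInChart_pullbackForm (I' := 𝓘(ℝ, E')) G₀ hq
      (hf.mdifferentiable (by simp) _) v w
    rw [mfderivWithin_eq_fderivWithin] at this
    exact this

lemma eventually_isPullbackAt_metricInChart [IsManifold I ∞ M] {f : M → E'}
    (hf : ContMDiff I 𝓘(ℝ, E') ∞ f)
    (hinv : ∀ x, (show E →L[ℝ] E' from mfderiv I 𝓘(ℝ, E') f x).IsInvertible)
    {G₀ : E' → E' →L[ℝ] E' →L[ℝ] ℝ} (hG₀ : ∀ x, ContDiffAt ℝ ∞ G₀ (f x))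
    (hsymm : ∀ y v w, G₀ y v w = G₀ y w v) (hG₀inv : ∀ x, (G₀ (f x)).IsInvertible) (x : M) :
    ∀ᶠ q in 𝓝[range I] (extChartAt I x x),
      Coord.IsPullbackAt (range I) (metricInChart I (pullbackForm I 𝓘(ℝ, E') f G₀) x)
        (f ∘ (extChartAt I x).symm) G₀ q :=
  Filter.mem_of_superset (extChartAt_target_mem_nhdsWithin x) fun _ hq ↦
    isPullbackAt_metricInChart hf hinv hG₀ hsymm hG₀inv hq

lemma solvesCriticalEquation_iff
    {g : Π y : M, TangentSpace I y →L[ℝ] TangentSpace I y →L[ℝ] ℝ} {F : M → ℝ} :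
    SolvesCriticalEquation I g F ↔ ∀ x : M, Coord.SolvesCriticalEquationAt (range I)
      (metricInChart I g x) (F ∘ (extChartAt I x).symm) (extChartAt I x x) := by
  refine forall_congr' fun x ↦ forall_congr' fun v ↦ forall_congr' fun w ↦ ?_
  simp

/-- If `F₀` solves the critical equation of the form `G₀` at all points `f x`, where `f` is a
local diffeomorphism, then `F₀ ∘ f` solves the critical equation of `f^* G₀`. -/
lemma solvesCriticalEquation_pullbackForm [IsManifold I ∞ M] [FiniteDimensional ℝ E]
    [FiniteDimensional ℝ E'] {f : M → E'}
    (hf : ContMDiff I 𝓘(ℝ, E') ∞ f)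
    (hinv : ∀ x, (show E →L[ℝ] E' from mfderiv I 𝓘(ℝ, E') f x).IsInvertible)
    {G₀ : E' → E' →L[ℝ] E' →L[ℝ] ℝ} (hG₀ : ∀ x, ContDiffAt ℝ ∞ G₀ (f x))
    (hsymm : ∀ y v w, G₀ y v w = G₀ y w v) (hG₀inv : ∀ x, (G₀ (f x)).IsInvertible)
    {F₀ : E' → ℝ} (hF₀ : ∀ x, ContDiffAt ℝ ∞ F₀ (f x))
    (hsol : ∀ x, Coord.SolvesCriticalEquationAt univ G₀ F₀ (f x)) :
    SolvesCriticalEquation I (pullbackForm I 𝓘(ℝ, E') f G₀) (F₀ ∘ f) := by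
  refine solvesCriticalEquation_iff.2 fun x ↦ ?_
  have hx : f ((extChartAt I x).symm (extChartAt I x x)) = f x := by
    rw [extChartAt_to_inv]
  refine Coord.SolvesCriticalEquationAt.pullback (Φ := f ∘ (extChartAt I x).symm) (F₀ := F₀)
    (by rw [Function.comp_apply, hx]; exact hsol x)
    (extChartAt_target_subset_range x (mem_extChartAt_target x))
    (eventually_isPullbackAt_metricInChart hf hinv hG₀ hsymm hG₀inv x)
    (by rw [Function.comp_apply, hx]; exact (hF₀ x).of_le (WithTop.coe_le_coe.2 le_top))
    Filter.EventuallyEq.rfl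

lemma isSmoothMetric_pullbackForm [IsManifold I ∞ M] [FiniteDimensional ℝ E] {f : M → E'}
    (hf : ContMDiff I 𝓘(ℝ, E') ∞ f)
    (hinv : ∀ x, (show E →L[ℝ] E' from mfderiv I 𝓘(ℝ, E') f x).IsInvertible)
    {G₀ : E' → E' →L[ℝ] E' →L[ℝ] ℝ} (hG₀ : ∀ x, ContDiffAt ℝ ∞ G₀ (f x))
    (hsymm : ∀ y v w, G₀ y v w = G₀ y w v) (hG₀inv : ∀ x, (G₀ (f x)).IsInvertible)
    (hpos : ∀ x v, v ≠ 0 → 0 < G₀ (f x) v v) :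
    IsSmoothMetric I (pullbackForm I 𝓘(ℝ, E') f G₀) := by
  refine isSmoothMetric_of_contDiffWithinAt_metricInChart (fun x v w ↦ hsymm _ _ _)
    (fun x v hv ↦ hpos x _ ?_) fun x ↦
      (isPullbackAt_metricInChart hf hinv hG₀ hsymm hG₀inv
        (mem_extChartAt_target x)).contDiffWithinAt_form
  obtain ⟨e, he⟩ := hinv x
  intro h0
  have h1 : e v = 0 := by
    rw [← ContinuousLinearEquiv.coe_coe, he]
    exact h0
  exact hv (e.map_eq_zero_iff.1 h1)

end General

/-! ### The inclusion and polar coordinates are local diffeomorphisms -/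

section LocalDiffeomorphisms

/-- A linear injection between spaces of the same finite dimension is invertible. -/
lemma isInvertible_of_injective {E E' : Type*} [NormedAddCommGroup E] [NormedSpace ℝ E]
    [NormedAddCommGroup E'] [NormedSpace ℝ E'] [FiniteDimensional ℝ E] [FiniteDimensional ℝ E']
    (h : Module.finrank ℝ E = Module.finrank ℝ E') {A : E →L[ℝ] E'} (hA : ∀ v, A v = 0 → v = 0) :
    A.IsInvertible := by
  have hinj : Function.Injective (A : E →ₗ[ℝ] E') := by
    rw [← LinearMap.ker_eq_bot, LinearMap.ker_eq_bot']
    exact hA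
  exact ⟨(LinearEquiv.ofInjectiveOfFinrankEq (A : E →ₗ[ℝ] E') hinj h).toContinuousLinearEquiv, rfl⟩

/-- In the preferred charts the inclusion coincides with the identity near the point. -/
lemma mfderiv_subtypeVal_opens {E : Type*} [NormedAddCommGroup E] [NormedSpace ℝ E]
    (U : TopologicalSpace.Opens E) (x : U) :
    mfderiv 𝓘(ℝ, E) 𝓘(ℝ, E) ((↑) : U → E) x = ContinuousLinearMap.id ℝ E := by
  have h1 : MDifferentiableAt 𝓘(ℝ, E) 𝓘(ℝ, E) ((↑) : U → E) x :=
    (contMDiff_subtype_val (n := 1) (I := 𝓘(ℝ, E)) (U := U)).mdifferentiable (by simp) x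
  have h2 := TopologicalSpace.Opens.chartAt_subtype_val_symm_eventuallyEq (H := E) U (x := x)
  rw [h1.mfderiv]
  have h3 : writtenInExtChartAt 𝓘(ℝ, E) 𝓘(ℝ, E) x ((↑) : U → E)
      =ᶠ[𝓝 (extChartAt 𝓘(ℝ, E) x x)] id := by
    have h4 := h2.symm
    exact h4
  simp only [ModelWithCorners.range_eq_univ, fderivWithin_univ]
  rw [h3.fderiv_eq, fderiv_id]

/-- The tangent space is a line, and its vector 1 is sent to 1; this also covers the endpoints. -/
lemma injective_mfderiv_subtypeVal_Icc {a b : ℝ} [Fact (a < b)] (x : Icc a b)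
    (v : TangentSpace (𝓡∂ 1) x)
    (hv : mfderiv (𝓡∂ 1) 𝓘(ℝ) (Subtype.val : Icc a b → ℝ) x v = 0) : v = 0 := by
  let A : EuclideanSpace ℝ (Fin 1) →L[ℝ] ℝ := mfderiv (𝓡∂ 1) 𝓘(ℝ) (Subtype.val : Icc a b → ℝ) x
  let u : EuclideanSpace ℝ (Fin 1) := (1 : TangentSpace (𝓡∂ 1) x)
  have hu : A u = 1 := mfderiv_subtypeVal_Icc_one x
  have hu0 : u ≠ 0 := by
    intro h
    rw [h, map_zero] at hu
    exact zero_ne_one hu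
  obtain ⟨c, hc⟩ := exists_smul_eq_of_finrank_eq_one
    (finrank_euclideanSpace_fin (𝕜 := ℝ) (n := 1)) hu0 (v : EuclideanSpace ℝ (Fin 1))
  have h1 : A v = 0 := hv
  rw [← hc, map_smul, hu, smul_eq_mul, mul_one] at h1
  rw [← hc, h1, zero_smul]
  rfl

variable {k : ℕ} {a b : ℝ}

lemma polar_ne_zero (ha : 0 < a) (x : Shell k a b) : polar k a b x ≠ 0 := by
  rw [← norm_pos_iff, norm_polar ha]
  exact ha.trans_le x.1.2.1

variable [Fact (a < b)]

lemma contMDiff_shell_fst :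
    ContMDiff (shellModel k) 𝓘(ℝ, ℝ) ∞ (fun x : Shell k a b ↦ (x.1 : ℝ)) :=
  contMDiff_subtypeVal_Icc.comp
    (contMDiff_fst : ContMDiff (shellModel k) (𝓡∂ 1) ∞ (Prod.fst : Shell k a b → _))

lemma contMDiff_shell_snd :
    ContMDiff (shellModel k) 𝓘(ℝ, Eucl k) ∞ (fun x : Shell k a b ↦ (x.2 : Eucl k)) :=
  (contMDiff_coe_sphere (E := Eucl k) (n := k)).comp
    (contMDiff_snd : ContMDiff (shellModel k) (𝓡 k) ∞ (Prod.snd : Shell k a b → _))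

lemma contMDiff_polar : ContMDiff (shellModel k) 𝓘(ℝ, Eucl k) ∞ (polar k a b) :=
  contMDiff_shell_fst.smul contMDiff_shell_snd

/-- The maps p ↦ ‖p‖ and p ↦ p/‖p‖ recover radius and direction, so a vector in the kernel has both
components zero; the dimensions 1 + k and k + 1 agree. -/
lemma isInvertible_mfderiv_polar (ha : 0 < a) (x : Shell k a b) :
    (show EuclideanSpace ℝ (Fin 1) × EuclideanSpace ℝ (Fin k) →L[ℝ] Eucl k from
      mfderiv (shellModel k) 𝓘(ℝ, Eucl k) (polar k a b) x).IsInvertible := by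
  refine isInvertible_of_injective ?_ fun (v : TangentSpace (shellModel k) x) hv ↦ ?_
  · simp [add_comm]
  have hv' : mfderiv (shellModel k) 𝓘(ℝ, Eucl k) (polar k a b) x v = 0 := hv
  have hp := contMDiff_polar.mdifferentiable (by simp) x
  -- a smooth function of the image has zero derivative in the direction `v`
  have key : ∀ {F : Type} [NormedAddCommGroup F] [NormedSpace ℝ F] (h : Eucl k → F),
      DifferentiableAt ℝ h (polar k a b x) →
      mfderiv (shellModel k) 𝓘(ℝ, F) (h ∘ polar k a b) x v = 0 := by
    intro F _ _ h hh
    rw [mfderiv_comp x hh.mdifferentiableAt hp]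
    exact (congrArg (mfderiv 𝓘(ℝ, Eucl k) 𝓘(ℝ, F) h (polar k a b x)) hv').trans (map_zero _)
  have hne := polar_ne_zero ha x
  have hnorm : DifferentiableAt ℝ (fun p : Eucl k ↦ ‖p‖) (polar k a b x) :=
    (contDiffAt_norm ℝ hne (n := 1)).differentiableAt (by simp)
  have h1 : v.1 = 0 := by
    apply injective_mfderiv_subtypeVal_Icc x.1
    have h2 := key _ hnorm
    have h3 : (fun p : Eucl k ↦ ‖p‖) ∘ polar k a b =
        (Subtype.val : Icc a b → ℝ) ∘ (Prod.fst : Shell k a b → Icc a b) :=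
      funext fun y ↦ norm_polar ha y
    rw [h3, mfderiv_comp (I' := 𝓡∂ 1) x
      (contMDiff_subtypeVal_Icc.mdifferentiable one_ne_zero _) mdifferentiableAt_fst,
      mfderiv_fst] at h2
    exact h2
  have h2 : v.2 = 0 := by
    apply injective_mvfderiv_subtypeVal_sphere (E := Eucl k) (n := k) x.2
    have h2 := key (fun p : Eucl k ↦ ‖p‖⁻¹ • p) ((hnorm.inv (norm_ne_zero_iff.2 hne)).smul
      differentiableAt_id)
    have h3 : (fun p : Eucl k ↦ ‖p‖⁻¹ • p) ∘ polar k a b =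
        (Subtype.val : Sph k → Eucl k) ∘ (Prod.snd : Shell k a b → Sph k) := by
      funext y
      have hy : (y.1 : ℝ) ≠ 0 := (ha.trans_le y.1.2.1).ne'
      simp only [Function.comp_apply, norm_polar ha y]
      rw [polar, smul_smul, inv_mul_cancel₀ hy, one_smul]
    rw [h3, mfderiv_comp (I' := 𝓡 k) x
      ((contMDiff_coe_sphere (E := Eucl k) (n := k)).mdifferentiable one_ne_zero _)
      mdifferentiableAt_snd, mfderiv_snd] at h2
    refine Eq.trans ?_ (map_zero _).symm
    exact h2
  exact Prod.ext h1 h2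

end LocalDiffeomorphisms

/-! ### Global solutions and domains bounded by two spheres -/

section SchwarzschildDomains

variable {k : ℕ} {m : ℝ}

variable (k m) in
/-- The Schwarzschild form, as a map to bilinear forms. -/
abbrev schwarzschildBilin : Eucl k → Eucl k →L[ℝ] Eucl k →L[ℝ] ℝ :=
  Coord.conformalForm fun p ↦ conformalFactor k m ‖p‖

lemma contDiffAt_schwarzschildBilin (hm : 0 < m) {p : Eucl k} (hp : p ≠ 0) :
    ContDiffAt ℝ ∞ (schwarzschildBilin k m) p :=
  Coord.contDiffAt_conformalForm (contDiffAt_conformalFactor_norm hm hp)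

lemma schwarzschildBilin_symm (p v w : Eucl k) :
    schwarzschildBilin k m p v w = schwarzschildBilin k m p w v := by
  rw [Coord.conformalForm_apply, Coord.conformalForm_apply, real_inner_comm]

lemma schwarzschildBilin_pos (hm : 0 < m) {p : Eucl k} (hp : p ≠ 0) {v : Eucl k} (hv : v ≠ 0) :
    0 < schwarzschildBilin k m p v v := by
  rw [Coord.conformalForm_apply]
  exact mul_pos (conformalFactor_pos hm (norm_pos_iff.2 hp)) (real_inner_self_pos.2 hv)

lemma isInvertible_schwarzschildBilin (hm : 0 < m) {p : Eucl k} (hp : p ≠ 0) :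
    (schwarzschildBilin k m p).IsInvertible :=
  Coord.isInvertible_conformalForm (conformalFactor_pos hm (norm_pos_iff.2 hp)).ne'

/-- The radial solutions of the critical equation on the whole Schwarzschild manifold. -/
lemma exists_solution_puncturedSpace (hk : 2 ≤ k) (hm : 0 < m) :
    ∃ f : puncturedSpace k → ℝ, ContMDiff 𝓘(ℝ, Eucl k) 𝓘(ℝ, ℝ) ∞ f ∧
      SolvesCriticalEquation 𝓘(ℝ, Eucl k) (schwarzschildMetric k m) f := by
  have hne : ∀ x : puncturedSpace k, (x : Eucl k) ≠ 0 := fun x ↦ x.2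
  -- Any value of c would do here.
  refine ⟨(fun p : Eucl k ↦ criticalPotential k m 0 ‖p‖) ∘ Subtype.val, fun x ↦ ?_, ?_⟩
  · exact (contDiffAt_criticalPotential_norm hk hm 0 (hne x)).contMDiffAt.comp x
      (contMDiff_subtype_val x)
  · refine solvesCriticalEquation_pullbackForm (G₀ := schwarzschildBilin k m)
      contMDiff_subtype_val (fun x ↦ ?_)
      (fun x ↦ contDiffAt_schwarzschildBilin hm (hne x)) schwarzschildBilin_symm
      (fun x ↦ isInvertible_schwarzschildBilin hm (hne x))
      (fun x ↦ contDiffAt_criticalPotential_norm hk hm 0 (hne x))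
      (fun x ↦ solvesCriticalEquationAt_schwarzschildForm hk hm 0 (hne x))
    exact ⟨ContinuousLinearEquiv.refl ℝ _, (mfderiv_subtypeVal_opens _ x).symm⟩

variable {a b : ℝ} [hab : Fact (a < b)]

lemma boundary_shell {x : Shell k a b} (hx : x ∈ (shellModel k).boundary (Shell k a b)) :
    (x.1 : ℝ) = a ∨ (x.1 : ℝ) = b := by
  have h : (shellModel k).boundary (Shell k a b) = _ :=
    ModelWithCorners.boundary_of_boundaryless_right (I := 𝓡∂ 1) (J := 𝓡 k)
  rw [h, boundary_Icc] at hx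
  rcases hx.1 with h1 | h1
  · exact Or.inl (by rw [h1]; rfl)
  · exact Or.inr (by rw [mem_singleton_iff.1 h1]; rfl)

lemma isSmoothMetric_shellMetric (hm : 0 < m) (ha : 0 < a) :
    IsSmoothMetric (shellModel k) (shellMetric k m a b) :=
  isSmoothMetric_pullbackForm (G₀ := schwarzschildBilin k m)
    contMDiff_polar (isInvertible_mfderiv_polar ha)
    (fun x ↦ contDiffAt_schwarzschildBilin hm (polar_ne_zero ha x)) schwarzschildBilin_symm
    (fun x ↦ isInvertible_schwarzschildBilin hm (polar_ne_zero ha x))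
    (fun x _ hv ↦ schwarzschildBilin_pos hm (polar_ne_zero ha x) hv)

lemma contMDiff_criticalPotential_polar (hk : 2 ≤ k) (hm : 0 < m) (ha : 0 < a) (c : ℝ) :
    ContMDiff (shellModel k) 𝓘(ℝ, ℝ) ∞
      ((fun p : Eucl k ↦ criticalPotential k m c ‖p‖) ∘ polar k a b) := fun x ↦
  (contDiffAt_criticalPotential_norm hk hm c (polar_ne_zero ha x)).contMDiffAt.comp x
    (contMDiff_polar x)

lemma solvesCriticalEquation_shellMetric (hk : 2 ≤ k) (hm : 0 < m) (ha : 0 < a) (c : ℝ) :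
    SolvesCriticalEquation (shellModel k) (shellMetric k m a b)
      ((fun p : Eucl k ↦ criticalPotential k m c ‖p‖) ∘ polar k a b) :=
  solvesCriticalEquation_pullbackForm (G₀ := schwarzschildBilin k m)
    contMDiff_polar (isInvertible_mfderiv_polar ha)
    (fun x ↦ contDiffAt_schwarzschildBilin hm (polar_ne_zero ha x)) schwarzschildBilin_symm
    (fun x ↦ isInvertible_schwarzschildBilin hm (polar_ne_zero ha x))
    (fun x ↦ contDiffAt_criticalPotential_norm hk hm c (polar_ne_zero ha x))
    (fun x ↦ solvesCriticalEquationAt_schwarzschildForm hk hm c (polar_ne_zero ha x))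

/-- The Schwarzschild metric is critical on `a ≤ |x| ≤ b` if a radial solution vanishes at both
radii. -/
lemma isCriticalMetric_shellMetric (hk : 2 ≤ k) (hm : 0 < m) (ha : 0 < a) {c : ℝ}
    (h1 : criticalPotential k m c a = 0) (h2 : criticalPotential k m c b = 0) :
    IsCriticalMetric (shellModel k) (shellMetric k m a b) := by
  refine ⟨isSmoothMetric_shellMetric hm ha, _, contMDiff_criticalPotential_polar hk hm ha c,
    fun x hx ↦ ?_, solvesCriticalEquation_shellMetric hk hm ha c⟩
  simp only [Function.comp_apply, norm_polar ha]
  rcases boundary_shell hx with h | h <;> rw [h] <;> assumption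

lemma sq_div_lt {r ρ : ℝ} (hr : 0 < r) (h : r < ρ) : r ^ 2 / ρ < r := by
  rw [div_lt_iff₀ (hr.trans h), sq]
  exact mul_lt_mul_of_pos_left h hr

/-- Take c with λ_c(ζ₁) = 0 and a zero ρ of λ_{-c} outside the horizon; then λ_c also vanishes at ζ₂
= ρ₀²/ρ. -/
lemma exists_inner_sphere (hk : 2 ≤ k) (hm : 0 < m) {ζ₁ : ℝ} (h1 : horizonRadius k m < ζ₁) :
    ∃ ζ₂ : ℝ, 0 < ζ₂ ∧ ζ₂ < horizonRadius k m ∧ ∃ _ : Fact (ζ₂ < ζ₁),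
      IsCriticalMetric (shellModel k) (shellMetric k m ζ₂ ζ₁) := by
  have hr := horizonRadius_pos k hm
  obtain ⟨c, hc⟩ := exists_criticalPotential_eq_zero_at hk hm h1
  obtain ⟨ρ, hρ, hρ0⟩ := exists_criticalPotential_eq_zero hk hm (-c)
  have hpos : 0 < horizonRadius k m ^ 2 / ρ := div_pos (pow_pos hr 2) (hr.trans hρ)
  have hlt := sq_div_lt hr hρ
  refine ⟨_, hpos, hlt, ⟨hlt.trans h1⟩, ?_⟩
  have := Fact.mk (hlt.trans h1)
  refine isCriticalMetric_shellMetric hk hm hpos (c := c) ?_ hc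
  rw [criticalPotential_reflection hk hm c (hr.trans hρ), hρ0]

/-- The inner sphere is reflected outward to choose c; reflecting back shows that λ_{-c} vanishes at
ζ₂, and it has another zero outside. -/
lemma exists_outer_sphere (hk : 2 ≤ k) (hm : 0 < m) {ζ₂ : ℝ} (h0 : 0 < ζ₂)
    (h2 : ζ₂ < horizonRadius k m) :
    ∃ ζ₁ : ℝ, horizonRadius k m < ζ₁ ∧ ∃ _ : Fact (ζ₂ < ζ₁),
      IsCriticalMetric (shellModel k) (shellMetric k m ζ₂ ζ₁) := by
  have hr := horizonRadius_pos k hm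
  have h1 : horizonRadius k m < horizonRadius k m ^ 2 / ζ₂ := by
    rw [lt_div_iff₀ h0, sq]
    exact mul_lt_mul_of_pos_left h2 hr
  obtain ⟨c, hc⟩ := exists_criticalPotential_eq_zero_at hk hm h1
  rw [criticalPotential_reflection hk hm c h0] at hc
  obtain ⟨ζ₁, hζ₁, hζ₁0⟩ := exists_criticalPotential_eq_zero hk hm (-c)
  have := Fact.mk (h2.trans hζ₁)
  exact ⟨ζ₁, hζ₁, this, isCriticalMetric_shellMetric hk hm h0 hc hζ₁0⟩

end SchwarzschildDomains

/-! ### Descent of metrics and solutions to a quotient by a free action -/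

section QuotientByAction

variable {E H M Γ : Type*} [NormedAddCommGroup E] [NormedSpace ℝ E]
  [TopologicalSpace H] {I : ModelWithCorners ℝ E H} [TopologicalSpace M] [ChartedSpace H M]
  [Group Γ] [MulAction Γ M] [ProperlyDiscontinuousSMul Γ M]
  [ContinuousConstSMul Γ M] [IsCancelSMul Γ M] [T2Space M] [LocallyCompactSpace M]

variable (Γ) in
/-- The projection to the quotient by a group action. -/
abbrev orbitProj (x : M) : MulAction.orbitRel.Quotient Γ M := Quotient.mk _ x

variable (Γ M) in
lemma isLocalHomeomorph_orbitProj : IsLocalHomeomorph (orbitProj Γ : M → _) :=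
  isQuotientCoveringMap_quotientMk_of_properlyDiscontinuousSMul.isCoveringMap.isLocalHomeomorph

/-- The base points of the charts of the quotient. -/
def orbitSection (q : MulAction.orbitRel.Quotient Γ M) : M :=
  (Quotient.mk_surjective (s := MulAction.orbitRel Γ M)).hasRightInverse.choose q

omit [TopologicalSpace M] [ProperlyDiscontinuousSMul Γ M]
  [ContinuousConstSMul Γ M] [IsCancelSMul Γ M] [T2Space M] [LocallyCompactSpace M] in
lemma orbitProj_orbitSection (q : MulAction.orbitRel.Quotient Γ M) :
    orbitProj Γ (orbitSection q) = q :=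
  (Quotient.mk_surjective (s := MulAction.orbitRel Γ M)).hasRightInverse.choose_spec q

/-- The chart at q is, by definition, a local inverse of the projection followed by the chart of M
at the chosen lift; `orbitSection` makes the same choice of lift, hence `rfl`. -/
lemma extChartAt_quotient_symm (q : MulAction.orbitRel.Quotient Γ M) :
    ((extChartAt I q).symm : E → _) = orbitProj Γ ∘ (extChartAt I (orbitSection q)).symm := by
  have h : chartAt H q = ((isLocalHomeomorph_orbitProj M Γ).localInverseAt (orbitSection q)).trans
    (chartAt H (orbitSection q)) := rfl
  funext p
  simp [extChartAt, h]

lemma extChartAt_quotient (q : MulAction.orbitRel.Quotient Γ M) :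
    (extChartAt I q : _ → E) = extChartAt I (orbitSection q) ∘
      (isLocalHomeomorph_orbitProj M Γ).localInverseAt (orbitSection q) := by
  have h : chartAt H q = ((isLocalHomeomorph_orbitProj M Γ).localInverseAt (orbitSection q)).trans
    (chartAt H (orbitSection q)) := rfl
  funext p
  simp [extChartAt, h]

lemma extChartAt_quotient_self (q : MulAction.orbitRel.Quotient Γ M) :
    extChartAt I q q = extChartAt I (orbitSection q) (orbitSection q) := by
  have h := (isLocalHomeomorph_orbitProj M Γ).localInverseAt_apply_self (x := orbitSection q)
  rw [orbitProj_orbitSection] at h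
  rw [extChartAt_quotient, Function.comp_apply, h]

lemma extChartAt_quotient_target_subset (q : MulAction.orbitRel.Quotient Γ M) :
    (extChartAt I q).target ⊆ (extChartAt I (orbitSection q)).target := by
  have h : chartAt H q = ((isLocalHomeomorph_orbitProj M Γ).localInverseAt (orbitSection q)).trans
    (chartAt H (orbitSection q)) := rfl
  intro p hp
  rw [extChartAt_target] at hp ⊢
  rw [h, OpenPartialHomeomorph.trans_target] at hp
  exact ⟨hp.1.1, hp.2⟩

omit [TopologicalSpace M] [ProperlyDiscontinuousSMul Γ M]
  [ContinuousConstSMul Γ M] [IsCancelSMul Γ M] [T2Space M] [LocallyCompactSpace M] in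
lemma exists_smul_eq_orbitSection (x : M) : ∃ a : Γ, a • x = orbitSection (orbitProj Γ x) :=
  Quotient.exact (orbitProj_orbitSection (orbitProj Γ x))

/-- Near a point, the local inverse of the projection composed with the projection is a deck
transformation. -/
lemma localInverseAt_orbitProj_eventuallyEq {x y : M} {a : Γ} (ha : a • x = y) :
    ∀ᶠ w in 𝓝 x, (isLocalHomeomorph_orbitProj M Γ).localInverseAt y (orbitProj Γ w) = a • w := by
  set s := (isLocalHomeomorph_orbitProj M Γ).localInverseAt y
  have hs : (s.symm : M → _) = orbitProj Γ :=
    (isLocalHomeomorph_orbitProj M Γ).localInverseAt_symm y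
  have hy : a • x ∈ s.target := by
    rw [ha]
    exact (isLocalHomeomorph_orbitProj M Γ).self_mem_localInverseAt_target
  have hc : ContinuousAt (fun w : M ↦ a • w) x := (continuous_const_smul a).continuousAt
  filter_upwards [hc.eventually (s.open_target.mem_nhds hy)] with w hw
  have : orbitProj Γ w = s.symm (a • w) := by
    rw [hs]
    exact (Quotient.sound ⟨a, rfl⟩ : orbitProj Γ (a • w) = _).symm
  rw [this, s.right_inv hw]

/-- Read in the chart at the image of x, the projection is near x a deck transformation followed by
a chart of M. -/
lemma contMDiff_orbitProj [IsManifold I ∞ M]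
    (hsm : ∀ a : Γ, ContMDiff I I ∞ (fun x : M ↦ a • x)) :
    ContMDiff I I ∞ (orbitProj Γ : M → _) := by
  intro x
  obtain ⟨a, ha⟩ := exists_smul_eq_orbitSection (Γ := Γ) x
  rw [contMDiffAt_iff_target]
  refine ⟨(isLocalHomeomorph_orbitProj M Γ).continuous.continuousAt, ?_⟩
  have h1 : ContMDiffAt I 𝓘(ℝ, E) ∞
      (fun w ↦ extChartAt I (orbitSection (orbitProj Γ x)) (a • w)) x :=
    (contMDiffAt_extChartAt' (by rw [ha]; exact mem_chart_source H _)).comp x (hsm a x)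
  refine h1.congr_of_eventuallyEq ?_
  filter_upwards [localInverseAt_orbitProj_eventuallyEq ha] with w hw
  rw [extChartAt_quotient, Function.comp_apply, Function.comp_apply, hw]

/-- In the preferred charts the derivative of the projection is the one of a deck
transformation. -/
lemma mfderiv_orbitProj [IsManifold I ∞ M]
    (hsm : ∀ a : Γ, ContMDiff I I ∞ (fun x : M ↦ a • x)) {x : M} {a : Γ}
    (ha : a • x = orbitSection (orbitProj Γ x)) :
    (show E →L[ℝ] E from mfderiv I I (orbitProj Γ : M → _) x) =
      (show E →L[ℝ] E from mfderiv I I (fun w : M ↦ a • w) x) := by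
  have h1 := (contMDiff_orbitProj hsm).mdifferentiable (by simp) x
  have h2 := (hsm a).mdifferentiable (by simp) x
  rw [h1.mfderiv, h2.mfderiv]
  have hc : ContinuousWithinAt (extChartAt I x).symm (range I) (extChartAt I x x) :=
    (continuousAt_extChartAt_symm x).continuousWithinAt
  have hx : (extChartAt I x).symm (extChartAt I x x) = x := extChartAt_to_inv x
  have hev := localInverseAt_orbitProj_eventuallyEq ha
  rw [← hx] at hev
  refine Filter.EventuallyEq.fderivWithin_eq ?_ ?_
  · filter_upwards [hc.eventually hev] with p hp
    simp only [writtenInExtChartAt, Function.comp_apply, extChartAt_quotient]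
    rw [hx] at hp
    rw [hp, ha]
  · have hp := hev.self_of_nhds
    rw [hx] at hp
    simp only [writtenInExtChartAt, Function.comp_apply, extChartAt_quotient]
    rw [hx, hp, ha]

/-- The form induced on the quotient by an invariant field of bilinear forms. -/
def quotientForm (g : Π y : M, TangentSpace I y →L[ℝ] TangentSpace I y →L[ℝ] ℝ)
    (q : MulAction.orbitRel.Quotient Γ M) :
    TangentSpace I q →L[ℝ] TangentSpace I q →L[ℝ] ℝ :=
  (show E →L[ℝ] E →L[ℝ] ℝ from g (orbitSection q))

variable {g : Π y : M, TangentSpace I y →L[ℝ] TangentSpace I y →L[ℝ] ℝ}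

/-- The induced form at q is g at the lift of q. The projection has at x the derivative of the deck
transformation moving x to that lift, so invariance of g gives the claim. -/
lemma pullbackForm_quotientForm [IsManifold I ∞ M]
    (hsm : ∀ a : Γ, ContMDiff I I ∞ (fun x : M ↦ a • x))
    (hg : ∀ (a : Γ) (x : M), pullbackForm I I (fun w : M ↦ a • w) g x = g x) (x : M) :
    pullbackForm I I (orbitProj Γ) (quotientForm g) x = g x := by
  obtain ⟨a, ha⟩ := exists_smul_eq_orbitSection (Γ := Γ) x
  rw [← hg a x]
  have key : ∀ y : M, a • x = y →
      (show E →L[ℝ] E →L[ℝ] ℝ from g (a • x)) = (show E →L[ℝ] E →L[ℝ] ℝ from g y) := by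
    rintro _ rfl
    rfl
  have h1 := mfderiv_orbitProj hsm ha
  simp only [pullbackForm, quotientForm]
  exact congrArg₂ (fun (B : E →L[ℝ] E →L[ℝ] ℝ) (D : E →L[ℝ] E) ↦ B.bilinearComp D D)
    (key _ ha).symm h1

/-- The inverse chart at q is the projection after the inverse chart at the lift, and the induced
form pulls back to g along the projection. -/
lemma metricInChart_quotientForm [IsManifold I ∞ M]
    (hsm : ∀ a : Γ, ContMDiff I I ∞ (fun x : M ↦ a • x))
    (hg : ∀ (a : Γ) (x : M), pullbackForm I I (fun w : M ↦ a • w) g x = g x)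
    {q : MulAction.orbitRel.Quotient Γ M} {p : E} (hp : p ∈ (extChartAt I q).target) :
    metricInChart I (quotientForm g) q p = metricInChart I g (orbitSection q) p := by
  have h1 : pullbackForm I I (orbitProj Γ) (quotientForm g) = g :=
    funext (pullbackForm_quotientForm hsm hg)
  ext v w
  conv_rhs => rw [← h1]
  rw [metricInChart_pullbackForm _ (extChartAt_quotient_target_subset q hp)
    ((contMDiff_orbitProj hsm).mdifferentiable (by simp) _)]
  have key : ∀ σ : E → MulAction.orbitRel.Quotient Γ M, ((extChartAt I q).symm : E → _) = σ →
      metricInChart I (quotientForm g) q p v w =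
        quotientForm g (σ p) (mfderivWithin 𝓘(ℝ, E) I σ (range I) p v)
          (mfderivWithin 𝓘(ℝ, E) I σ (range I) p w) := by
    rintro _ rfl
    rfl
  exact key _ (extChartAt_quotient_symm q)

/-- A point and its lift have the same coordinates in their preferred charts. -/
lemma mem_boundary_of_quotient {q : MulAction.orbitRel.Quotient Γ M}
    (hq : q ∈ I.boundary (MulAction.orbitRel.Quotient Γ M)) :
    orbitSection q ∈ I.boundary M := by
  have h1 : I.IsBoundaryPoint q := hq
  have h2 : I.IsBoundaryPoint (orbitSection q) := by
    rw [ModelWithCorners.isBoundaryPoint_iff] at h1 ⊢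
    rwa [← extChartAt_quotient_self]
  exact h2

omit [TopologicalSpace M] [ProperlyDiscontinuousSMul Γ M]
  [ContinuousConstSMul Γ M] [IsCancelSMul Γ M] [T2Space M] [LocallyCompactSpace M] in
lemma comp_orbitSection_comp_orbitProj {F : M → ℝ} (hF : ∀ (a : Γ) (x : M), F (a • x) = F x) :
    (F ∘ orbitSection) ∘ orbitProj Γ = F := by
  funext x
  obtain ⟨a, ha⟩ := exists_smul_eq_orbitSection (Γ := Γ) x
  rw [Function.comp_apply, Function.comp_apply, ← ha, hF]

lemma comp_orbitSection_comp_extChartAt_symm {F : M → ℝ}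
    (hF : ∀ (a : Γ) (x : M), F (a • x) = F x) (q : MulAction.orbitRel.Quotient Γ M) :
    (F ∘ orbitSection) ∘ (extChartAt I q).symm = F ∘ (extChartAt I (orbitSection q)).symm := by
  rw [extChartAt_quotient_symm, ← Function.comp_assoc, comp_orbitSection_comp_orbitProj hF]

lemma contMDiff_comp_orbitSection {F : M → ℝ}
    (hF : ∀ (a : Γ) (x : M), F (a • x) = F x) (hFsm : ContMDiff I 𝓘(ℝ, ℝ) ∞ F) :
    ContMDiff I 𝓘(ℝ, ℝ) ∞ (F ∘ (orbitSection : MulAction.orbitRel.Quotient Γ M → M)) := by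
  intro q
  rw [contMDiffAt_iff_source, comp_orbitSection_comp_extChartAt_symm hF, extChartAt_quotient_self]
  exact contMDiffAt_iff_source.1 (hFsm (orbitSection q))

/-- A metric `f^* G₀` that is invariant under a free group action induces a critical metric on the
compact quotient, if an invariant solution `F₀ ∘ f` of the critical equation vanishes on the
boundary. -/
lemma isCriticalMetric_quotientForm {E' : Type*} [NormedAddCommGroup E'] [NormedSpace ℝ E']
    [FiniteDimensional ℝ E] [FiniteDimensional ℝ E']
    [IsManifold I ∞ M] [IsManifold I ∞ (MulAction.orbitRel.Quotient Γ M)]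
    [T2Space (MulAction.orbitRel.Quotient Γ M)] [CompactSpace (MulAction.orbitRel.Quotient Γ M)]
    (hsm : ∀ a : Γ, ContMDiff I I ∞ (fun x : M ↦ a • x))
    {f : M → E'} (hf : ContMDiff I 𝓘(ℝ, E') ∞ f)
    (hinv : ∀ x, (show E →L[ℝ] E' from mfderiv I 𝓘(ℝ, E') f x).IsInvertible)
    {G₀ : E' → E' →L[ℝ] E' →L[ℝ] ℝ} (hG₀ : ∀ x, ContDiffAt ℝ ∞ G₀ (f x))
    (hsymm : ∀ y v w, G₀ y v w = G₀ y w v) (hG₀inv : ∀ x, (G₀ (f x)).IsInvertible)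
    (hpos : ∀ x v, v ≠ 0 → 0 < G₀ (f x) v v)
    {F₀ : E' → ℝ} (hF₀ : ∀ x, ContDiffAt ℝ ∞ F₀ (f x))
    (hsol : ∀ x, Coord.SolvesCriticalEquationAt univ G₀ F₀ (f x))
    (hg : ∀ (a : Γ) (x : M), pullbackForm I I (fun w : M ↦ a • w)
      (pullbackForm I 𝓘(ℝ, E') f G₀) x = pullbackForm I 𝓘(ℝ, E') f G₀ x)
    (hF : ∀ (a : Γ) (x : M), F₀ (f (a • x)) = F₀ (f x))
    (hbd : ∀ x ∈ I.boundary M, F₀ (f x) = 0) :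
    IsCriticalMetric (M := MulAction.orbitRel.Quotient Γ M) I
      (quotientForm (pullbackForm I 𝓘(ℝ, E') f G₀)) := by
  have hF' : ∀ (a : Γ) (x : M), (F₀ ∘ f) (a • x) = (F₀ ∘ f) x := hF
  have heq : ∀ (q : MulAction.orbitRel.Quotient Γ M), ∀ p ∈ (extChartAt I q).target,
      metricInChart I (quotientForm (pullbackForm I 𝓘(ℝ, E') f G₀)) q =ᶠ[𝓝[range I] p]
        metricInChart I (pullbackForm I 𝓘(ℝ, E') f G₀) (orbitSection q) := fun q p hp ↦
    Filter.mem_of_superset (extChartAt_target_mem_nhdsWithin_of_mem hp) fun _ hp' ↦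
      metricInChart_quotientForm hsm hg hp'
  -- The map f need not descend to the quotient; only its expression in the chart at the lift is
  -- used.
  have hpb : ∀ (q : MulAction.orbitRel.Quotient Γ M), ∀ p ∈ (extChartAt I q).target,
      Coord.IsPullbackAt (range I)
        (metricInChart I (quotientForm (pullbackForm I 𝓘(ℝ, E') f G₀)) q)
        (f ∘ (extChartAt I (orbitSection q)).symm) G₀ p := fun q p hp ↦
    let h := isPullbackAt_metricInChart hf hinv hG₀ hsymm hG₀inv
      (extChartAt_quotient_target_subset q hp)
    { h with eventuallyEq := (heq q p hp).trans h.eventuallyEq }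
  have hmet := isSmoothMetric_pullbackForm hf hinv hG₀ hsymm hG₀inv hpos
  obtain ⟨G, hG⟩ := hmet
  refine ⟨isSmoothMetric_of_contDiffWithinAt_metricInChart (fun q v w ↦ hsymm _ _ _)
    (fun q v hv ↦ ?_) fun q ↦ (hpb q _ (mem_extChartAt_target q)).contDiffWithinAt_form,
    (F₀ ∘ f) ∘ orbitSection, contMDiff_comp_orbitSection hF' fun x ↦ ?_,
    fun q hq ↦ hbd _ (mem_boundary_of_quotient hq), solvesCriticalEquation_iff.2 fun q ↦ ?_⟩
  · have h1 := G.pos (orbitSection q) v hv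
    rw [hG] at h1
    exact h1
  · exact (hF₀ x).contMDiffAt.comp x (hf x)
  · have hx : f ((extChartAt I (orbitSection q)).symm (extChartAt I q q)) =
        f (orbitSection q) := by
      rw [extChartAt_quotient_self, extChartAt_to_inv]
    rw [comp_orbitSection_comp_extChartAt_symm hF']
    refine Coord.SolvesCriticalEquationAt.pullback
      (Φ := f ∘ (extChartAt I (orbitSection q)).symm) (F₀ := F₀)
      (by rw [Function.comp_apply, hx]; exact hsol _)
      (extChartAt_target_subset_range q (mem_extChartAt_target q))
      (Filter.mem_of_superset (extChartAt_target_mem_nhdsWithin q) fun p hp ↦ hpb q p hp)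
      (by rw [Function.comp_apply, hx]; exact (hF₀ _).of_le (WithTop.coe_le_coe.2 le_top))
      Filter.EventuallyEq.rfl

end QuotientByAction

/-! ### The antipodal quotient along the horizon -/

section AntipodalQuotient

/-- If `f` intertwines `τ` with an isometry `Ψ` of `G₀`, then `τ` is an isometry of `f^* G₀`. -/
lemma pullbackForm_pullbackForm_of_isometry {E E' H M : Type*} [NormedAddCommGroup E]
    [NormedSpace ℝ E] [NormedAddCommGroup E'] [NormedSpace ℝ E'] [TopologicalSpace H]
    {I : ModelWithCorners ℝ E H} [TopologicalSpace M] [ChartedSpace H M]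
    {τ : M → M} {f : M → E'} {Ψ : E' → E'} {D : E' →L[ℝ] E'} {G₀ : E' → E' →L[ℝ] E' →L[ℝ] ℝ}
    {x : M} (hτ : MDifferentiableAt I I τ x) (hf : MDifferentiable I 𝓘(ℝ, E') f)
    (hcomp : f ∘ τ = Ψ ∘ f) (hΨ : HasFDerivAt Ψ D (f x))
    (hiso : ∀ v w, G₀ (Ψ (f x)) (D v) (D w) = G₀ (f x) v w) :
    pullbackForm I I τ (pullbackForm I 𝓘(ℝ, E') f G₀) x = pullbackForm I 𝓘(ℝ, E') f G₀ x := by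
  have h1 : (mfderiv I 𝓘(ℝ, E') f (τ x)).comp (mfderiv I I τ x) =
      mfderiv I 𝓘(ℝ, E') (Ψ ∘ f) x := by
    rw [← hcomp, mfderiv_comp x (hf _) hτ]
  rw [mfderiv_comp x hΨ.differentiableAt.mdifferentiableAt (hf x), mfderiv_eq_fderiv,
    hΨ.fderiv] at h1
  have h2 : ∀ v : TangentSpace I x, (mfderiv I 𝓘(ℝ, E') f (τ x) (mfderiv I I τ x v) : E') =
      D (mfderiv I 𝓘(ℝ, E') f x v) := fun v ↦ congrArg (fun A : E →L[ℝ] E' ↦ A v) h1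
  ext v w
  change G₀ (f (τ x)) (mfderiv I 𝓘(ℝ, E') f (τ x) (mfderiv I I τ x v) : E')
    (mfderiv I 𝓘(ℝ, E') f (τ x) (mfderiv I I τ x w) : E') =
    G₀ (f x) (mfderiv I 𝓘(ℝ, E') f x v : E') (mfderiv I 𝓘(ℝ, E') f x w : E')
  rw [h2, h2, show f (τ x) = Ψ (f x) from congrFun hcomp x]
  exact hiso _ _

open EuclideanGeometry in
/-- The inversion in the horizon is an isometry of the Schwarzschild metric. -/
lemma schwarzschildBilin_inversion {k : ℕ} {m : ℝ} (hk : 2 ≤ k) (hm : 0 < m) {p : Eucl k}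
    (hp : p ≠ 0) (v w : Eucl k) :
    schwarzschildBilin k m (-inversion 0 (horizonRadius k m) p)
      (-((horizonRadius k m / dist p 0) ^ 2 •
        ((ℝ ∙ (p - 0))ᗮ.reflection : Eucl k →L[ℝ] Eucl k)) v)
      (-((horizonRadius k m / dist p 0) ^ 2 •
        ((ℝ ∙ (p - 0))ᗮ.reflection : Eucl k →L[ℝ] Eucl k)) w) =
    schwarzschildBilin k m p v w := by
  have hr := horizonRadius_pos k hm
  have hp' := norm_pos_iff.2 hp
  have hn : ‖-inversion 0 (horizonRadius k m) p‖ = horizonRadius k m ^ 2 / ‖p‖ := by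
    rw [norm_neg, ← dist_zero_right, dist_inversion_center, dist_zero_right]
  have h1 := areaRadius_sq (k := k) hm (div_pos (pow_pos hr 2) hp')
  rw [areaRadius_reflection hk hm hp', areaRadius_sq hm hp'] at h1
  rw [Coord.conformalForm_apply, Coord.conformalForm_apply, hn]
  have h2 : inner ℝ ((ℝ ∙ (p - 0))ᗮ.reflection v) ((ℝ ∙ (p - 0))ᗮ.reflection w) = inner ℝ v w :=
    LinearIsometryEquiv.inner_map_map _ _ _
  simp only [smul_apply, inner_neg_neg,
    real_inner_smul_left, real_inner_smul_right, dist_zero_right]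
  erw [h2]
  -- Invariance of s² = ρ²φ means that φ gains (ρ/ρ₀)⁴ under the inversion, cancelling the square of
  -- the scale factor (ρ₀/ρ)² of its derivative.
  have h3 : conformalFactor k m (horizonRadius k m ^ 2 / ‖p‖) * (horizonRadius k m / ‖p‖) ^ 4 =
      conformalFactor k m ‖p‖ := by
    rw [← mul_right_inj' (pow_pos hp' 2).ne', h1]
    field_simp
  rw [← h3]
  ring

variable {k : ℕ} {b c : ℝ} [hbc : Fact (0 < b ∧ b < c)]

lemma sq_div_pos_of_fact : 0 < b ^ 2 / c :=
  div_pos (pow_pos hbc.out.1 2) (hbc.out.1.trans hbc.out.2)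

lemma doubled_fst_pos (x : Doubled k b c) : 0 < (x.1 : ℝ) :=
  (sq_div_pos_of_fact (b := b) (c := c)).trans_le x.1.2.1

-- Polar coordinates conjugate the reflection to p ↦ -b²p/‖p‖², a map of the ambient space with a
-- known derivative.
open EuclideanGeometry in
lemma polar_antipodalReflection (x : Doubled k b c) :
    polar k (b ^ 2 / c) c (antipodalReflection k b c x) =
      -inversion 0 b (polar k (b ^ 2 / c) c x) := by
  have hx := doubled_fst_pos x
  have hp : ∀ y : Doubled k b c, polar k (b ^ 2 / c) c y = (y.1 : ℝ) • (y.2 : Eucl k) :=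
    fun _ ↦ rfl
  have hn : dist (polar k (b ^ 2 / c) c x) 0 = x.1 := by
    rw [dist_zero_right]
    exact norm_polar sq_div_pos_of_fact x
  rw [inversion, hn, vsub_eq_sub, vadd_eq_add, sub_zero, add_zero, hp, hp,
    antipodalReflection_snd, antipodalReflection_fst, smul_smul, coe_neg_sphere, smul_neg]
  congr 2
  field_simp

/-- The reflection replaces c by -c, so c = 0 gives an invariant solution. -/
lemma criticalPotential_polar_smul {m : ℝ} [Fact (0 < horizonRadius k m ∧ horizonRadius k m < c)]
    (hk : 2 ≤ k) (hm : 0 < m) (ε : ℤˣ) (x : Doubled k (horizonRadius k m) c) :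
    criticalPotential k m 0 ‖polar k (horizonRadius k m ^ 2 / c) c (ε • x)‖ =
      criticalPotential k m 0 ‖polar k (horizonRadius k m ^ 2 / c) c x‖ := by
  rcases Int.units_eq_one_or ε with rfl | rfl
  · rw [one_smul]
  · have h1 : ‖polar k (horizonRadius k m ^ 2 / c) c ((-1 : ℤˣ) • x)‖ =
        horizonRadius k m ^ 2 / x.1 := by
      rw [neg_one_smul_doubled]
      exact norm_polar sq_div_pos_of_fact _
    have h2 : ‖polar k (horizonRadius k m ^ 2 / c) c x‖ = x.1 :=
      norm_polar sq_div_pos_of_fact _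
    rw [h1, h2, criticalPotential_reflection hk hm 0 (doubled_fst_pos x), neg_zero]

lemma contMDiff_polar_doubled :
    ContMDiff (M := Doubled k b c) (shellModel k) 𝓘(ℝ, Eucl k) ∞ (polar k (b ^ 2 / c) c) :=
  contMDiff_polar

lemma pullbackForm_smul_doubledMetric {m : ℝ}
    [Fact (0 < horizonRadius k m ∧ horizonRadius k m < c)] (hk : 2 ≤ k) (hm : 0 < m) (ε : ℤˣ)
    (x : Doubled k (horizonRadius k m) c) :
    pullbackForm (shellModel k) (shellModel k)
      (fun w : Doubled k (horizonRadius k m) c ↦ ε • w)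
      (pullbackForm (M := Doubled k (horizonRadius k m) c) (shellModel k) 𝓘(ℝ, Eucl k)
        (polar k (horizonRadius k m ^ 2 / c) c) (schwarzschildBilin k m)) x =
      pullbackForm (M := Doubled k (horizonRadius k m) c) (shellModel k) 𝓘(ℝ, Eucl k)
        (polar k (horizonRadius k m ^ 2 / c) c) (schwarzschildBilin k m) x := by
  have hτ := (contMDiff_smul_doubled k (horizonRadius k m) c ε).mdifferentiable (by simp) x
  have hf := (contMDiff_polar_doubled (k := k) (b := horizonRadius k m) (c := c)).mdifferentiable
    (by simp)
  rcases Int.units_eq_one_or ε with rfl | rfl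
  · refine pullbackForm_pullbackForm_of_isometry (Ψ := id) hτ hf ?_ (hasFDerivAt_id _)
      fun _ _ ↦ rfl
    exact funext fun w ↦ congrArg (polar k (horizonRadius k m ^ 2 / c) c) (one_smul ℤˣ w)
  · have hne := polar_ne_zero (sq_div_pos_of_fact (b := horizonRadius k m) (c := c)) x
    refine pullbackForm_pullbackForm_of_isometry
      (Ψ := fun p ↦ -EuclideanGeometry.inversion 0 (horizonRadius k m) p) hτ hf ?_
      (EuclideanGeometry.hasFDerivAt_inversion hne).neg
      (schwarzschildBilin_inversion hk hm hne)
    funext w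
    simp only [neg_one_smul_doubled]
    exact polar_antipodalReflection w

lemma antipodalProj_eq_iff {x y : Doubled k b c} :
    antipodalProj k b c x = antipodalProj k b c y ↔ x = y ∨ x = antipodalReflection k b c y := by
  rw [antipodalProj, antipodalProj, Quotient.eq, MulAction.orbitRel_apply, MulAction.mem_orbit_iff]
  constructor
  · rintro ⟨ε, rfl⟩
    rcases Int.units_eq_one_or ε with rfl | rfl
    · exact Or.inl (one_smul _ _)
    · exact Or.inr (neg_one_smul_doubled ..)
  · rintro (rfl | rfl)
    · exact ⟨1, one_smul _ _⟩
    · exact ⟨-1, neg_one_smul_doubled ..⟩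

omit hbc in
lemma continuous_doubled_fst : Continuous fun x : Doubled k b c ↦ (x.1 : ℝ) :=
  continuous_subtype_val.comp (continuous_fst (X := Icc (b ^ 2 / c) c) (Y := Sph k))

omit hbc in
lemma sq_div_le_iff {t : ℝ} (hb : 0 < b) (ht : 0 < t) : b ^ 2 / t ≤ b ↔ b ≤ t := by
  rw [div_le_iff₀ ht, sq, mul_le_mul_iff_right₀ hb]

omit hbc in
lemma le_sq_div_iff {t : ℝ} (hb : 0 < b) (ht : 0 < t) : b ≤ b ^ 2 / t ↔ t ≤ b := by
  rw [le_div_iff₀ ht, sq, mul_le_mul_iff_right₀ hb]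

/-- A closed set that meets every orbit maps onto the quotient by a quotient map. -/
lemma isQuotientMap_antipodalProj {Ω : Set (Doubled k b c)} (hΩ : IsClosed Ω)
    (h : ∀ x, x ∈ Ω ∨ antipodalReflection k b c x ∈ Ω) :
    Topology.IsQuotientMap (Ω.domRestrict (antipodalProj k b c)) := by
  have hc : Continuous (antipodalProj k b c) := continuous_quotient_mk'
  have hcΩ : Continuous (Ω.domRestrict (antipodalProj k b c)) := hc.comp continuous_subtype_val
  have := isCompact_iff_compactSpace.1 hΩ.isCompact
  -- A continuous map from a compact space to a Hausdorff space is closed; surjectivity holds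
  -- because Ω meets every orbit.
  refine hcΩ.isClosedMap.isQuotientMap hcΩ fun q ↦ ?_
  obtain ⟨x, rfl⟩ := Quotient.mk_surjective q
  rcases h x with hx | hx
  · exact ⟨⟨x, hx⟩, rfl⟩
  · exact ⟨⟨_, hx⟩, antipodalProj_eq_iff.2 (Or.inr rfl)⟩

/-- Each half of the doubled domain is a fundamental domain, glued along the sphere `|x| = b`. -/
lemma fundamentalDomain_antipodalProj {Ω : Set (Doubled k b c)}
    (hΩ : Ω = {x | b ≤ (x.1 : ℝ)} ∨ Ω = {x | (x.1 : ℝ) ≤ b}) :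
    Topology.IsQuotientMap (Ω.domRestrict (antipodalProj k b c)) ∧
      ∀ x ∈ Ω, ∀ y ∈ Ω, (antipodalProj k b c x = antipodalProj k b c y ↔
        x = y ∨ ((x.1 : ℝ) = b ∧ (y.1 : ℝ) = b ∧ y.2 = -x.2)) := by
  have hcl : IsClosed Ω := by
    rcases hΩ with rfl | rfl
    · exact isClosed_le continuous_const continuous_doubled_fst
    · exact isClosed_le continuous_doubled_fst continuous_const
  have hor : ∀ x, x ∈ Ω ∨ antipodalReflection k b c x ∈ Ω := by
    intro x
    rcases hΩ with rfl | rfl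
    · exact (le_total b x.1).imp id (le_sq_div_iff hbc.out.1 (doubled_fst_pos x)).2
    · exact (le_total (x.1 : ℝ) b).imp id (sq_div_le_iff hbc.out.1 (doubled_fst_pos x)).2
  have hand : ∀ x, x ∈ Ω → antipodalReflection k b c x ∈ Ω → (x.1 : ℝ) = b := by
    intro x h1 h2
    rcases hΩ with rfl | rfl
    · exact le_antisymm ((le_sq_div_iff hbc.out.1 (doubled_fst_pos x)).1 h2) h1
    · exact le_antisymm h1 ((sq_div_le_iff hbc.out.1 (doubled_fst_pos x)).1 h2)
  have hdiv : b ^ 2 / b = b := by rw [sq, mul_self_div_self]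
  refine ⟨isQuotientMap_antipodalProj hcl hor, fun x hx y hy ↦ ?_⟩
  rw [antipodalProj_eq_iff]
  refine or_congr_right ⟨?_, fun ⟨h1, h2, h3⟩ ↦ Prod.ext (Subtype.ext ?_) ?_⟩
  · rintro rfl
    have h := hand y hy hx
    rw [antipodalReflection_fst, antipodalReflection_snd, h, neg_neg, hdiv]
    exact ⟨rfl, rfl, rfl⟩
  · rw [antipodalReflection_fst, h1, h2, hdiv]
  · rw [antipodalReflection_snd, h3, neg_neg]

/-- The radius θ is a zero of λ_0 outside the horizon; by invariance λ_0 also vanishes at ρ₀²/θ,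
hence on the whole boundary of the cover. -/
lemma exists_antipodalQuotient (hk : 2 ≤ k) {m : ℝ} (hm : 0 < m) :
    ∃ θ : ℝ, ∃ _ : Fact (0 < horizonRadius k m ∧ horizonRadius k m < θ),
      ∃ g : Π q : AntipodalQuotient k (horizonRadius k m) θ,
          TangentSpace (shellModel k) q →L[ℝ] TangentSpace (shellModel k) q →L[ℝ] ℝ,
        (∀ x, pullbackForm (shellModel k) (shellModel k)
            (antipodalProj k (horizonRadius k m) θ) g x =
          doubledMetric k (horizonRadius k m) θ m x) ∧
        IsCriticalMetric (shellModel k) g := by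
  have hr := horizonRadius_pos k hm
  obtain ⟨θ, hθ, hθ0⟩ := exists_criticalPotential_eq_zero hk hm 0
  have hfact : Fact (0 < horizonRadius k m ∧ horizonRadius k m < θ) := ⟨hr, hθ⟩
  have ha := sq_div_pos_of_fact (b := horizonRadius k m) (c := θ)
  have hsm := contMDiff_smul_doubled k (horizonRadius k m) θ
  have hne : ∀ x : Doubled k (horizonRadius k m) θ,
      polar k (horizonRadius k m ^ 2 / θ) θ x ≠ 0 := fun x ↦ polar_ne_zero ha x
  refine ⟨θ, hfact, quotientForm (pullbackForm (M := Doubled k (horizonRadius k m) θ)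
    (shellModel k) 𝓘(ℝ, Eucl k) (polar k (horizonRadius k m ^ 2 / θ) θ) (schwarzschildBilin k m)),
    fun x ↦ pullbackForm_quotientForm hsm (pullbackForm_smul_doubledMetric hk hm) x, ?_⟩
  refine isCriticalMetric_quotientForm hsm contMDiff_polar_doubled
    (isInvertible_mfderiv_polar ha) (fun x ↦ contDiffAt_schwarzschildBilin hm (hne x))
    schwarzschildBilin_symm (fun x ↦ isInvertible_schwarzschildBilin hm (hne x))
    (fun x v hv ↦ schwarzschildBilin_pos hm (hne x) hv)
    (fun x ↦ contDiffAt_criticalPotential_norm hk hm 0 (hne x))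
    (fun x ↦ solvesCriticalEquationAt_schwarzschildForm hk hm 0 (hne x))
    (pullbackForm_smul_doubledMetric hk hm) (criticalPotential_polar_smul hk hm) fun x hx ↦ ?_
  have hn : ‖polar k (horizonRadius k m ^ 2 / θ) θ x‖ = x.1 := norm_polar ha x
  rw [hn]
  have hx' : (x.1 : ℝ) = horizonRadius k m ^ 2 / θ ∨ (x.1 : ℝ) = θ := boundary_shell hx
  rcases hx' with h | h
  · rw [h, criticalPotential_reflection hk hm 0 (hr.trans hθ), neg_zero, hθ0]
  · rw [h, hθ0]

end AntipodalQuotient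

theorem mainTheorem6 (k : ℕ) (hk : 2 ≤ k) (m : ℝ) (hm : 0 < m) :
    -- (i) solutions on the whole Schwarzschild manifold
    (∃ f : puncturedSpace k → ℝ,
      ContMDiff 𝓘(ℝ, Eucl k) 𝓘(ℝ, ℝ) ∞ f ∧
      SolvesCriticalEquation 𝓘(ℝ, Eucl k) (schwarzschildMetric k m) f) ∧
    -- (ii) for every sphere on one side of the horizon there is one on the other side
    (∀ ζ₁ : ℝ, horizonRadius k m < ζ₁ →
      ∃ ζ₂ : ℝ, 0 < ζ₂ ∧ ζ₂ < horizonRadius k m ∧ ∃ _ : Fact (ζ₂ < ζ₁),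
        IsCriticalMetric (shellModel k) (shellMetric k m ζ₂ ζ₁)) ∧
    (∀ ζ₂ : ℝ, 0 < ζ₂ → ζ₂ < horizonRadius k m →
      ∃ ζ₁ : ℝ, horizonRadius k m < ζ₁ ∧ ∃ _ : Fact (ζ₂ < ζ₁),
        IsCriticalMetric (shellModel k) (shellMetric k m ζ₂ ζ₁)) ∧
    -- (iii) a domain between a sphere and the horizon, antipodally identified along the horizon
    (∃ θ : ℝ, ∃ _ : Fact (0 < horizonRadius k m ∧ horizonRadius k m < θ),
      (∀ Ω : Set (Doubled k (horizonRadius k m) θ),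
        (Ω = {x | horizonRadius k m ≤ (x.1 : ℝ)} ∨ Ω = {x | (x.1 : ℝ) ≤ horizonRadius k m}) →
        Topology.IsQuotientMap (Ω.domRestrict (antipodalProj k (horizonRadius k m) θ)) ∧
        ∀ x ∈ Ω, ∀ y ∈ Ω,
          (antipodalProj k (horizonRadius k m) θ x = antipodalProj k (horizonRadius k m) θ y ↔
            x = y ∨ ((x.1 : ℝ) = horizonRadius k m ∧ (y.1 : ℝ) = horizonRadius k m ∧
              y.2 = -x.2))) ∧
      ∃ g : Π q : AntipodalQuotient k (horizonRadius k m) θ,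
          TangentSpace (shellModel k) q →L[ℝ] TangentSpace (shellModel k) q →L[ℝ] ℝ,
        (∀ x, pullbackForm (shellModel k) (shellModel k)
            (antipodalProj k (horizonRadius k m) θ) g x =
          doubledMetric k (horizonRadius k m) θ m x) ∧
        IsCriticalMetric (shellModel k) g) := by
  obtain ⟨θ, hθ, g, hg⟩ := exists_antipodalQuotient hk hm
  exact ⟨exists_solution_puncturedSpace hk hm, fun _ ↦ exists_inner_sphere hk hm,
    fun _ ↦ exists_outer_sphere hk hm, θ, hθ, fun _ ↦ fundamentalDomain_antipodalProj, g, hg⟩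

end
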